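/- **Theorem 3.1.** *Setting.* Let $d\ge 1$, $p\in(1,\infty]$, $r>0$, and let $D$ be a probability distribution over $\mathbb R^d\times\{\pm1\}$. A classifier is a map $f:\mathbb R^d\to\{\pm1\}$; its standard loss is $\mathcal L(f,D)=P_{(x,y)\sim D}[f(x)\ne y]$ and its robust loss is $\mathcal L_r(f,D)=P_{(x,y)\sim D}[\exists x',\ \|x'-x\|_p\le r,\ f(x')\neq y]$. The linear classifier $f_{w,b}$ ($w\in\mathbb R^d$, $b\in\mathbb R$) equals $+1$ where $\langle w,x\rangle\ge b$ and $-1$ elsewhere. $D$ is linearly $r$-separable if $\mathcal L_r(f_{w,b},D)=0$ for some $w,b$. Let $S^{\pm}\subseteq\mathbb R^d$ be the sets of positively and negatively labeled points of the support of $D$. The margin $\gamma(D)$ is the largest real number $\gamma$ such that some $f_{w,b}$ has $\mathcal L(f_{w,b},D)=0$ and every point of $S^+\cup S^-$ has $\ell_2$ distance at least $\gamma$ from $\{z:\langle w,z\rangle=b\}$, and the aspect ratio is $\rho(D)=\mathrm{diam}_2(S^+\cup S^-)/\gamma(D)$. For $\rho>0$ let $\mathcal F_{r,\rho}$ be the set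 of all linearly $r$-separable $D$ over $\mathbb R^d\times\{\pm1\}$ that have a margin (so that both labels occur) and satisfy $\rho(D)\le\rho$. A learning algorithm $A$ maps each finite sample $S$ of labeled points to a classifier $A_S$, not necessarily linear. The hard-margin SVM $M$ returns, on every linearly separable sample $S=((x_i,y_i))_{i\le n}$, a classifier $f_{w,b}$ with $\|w\|_2$ minimal subject to $y_i(\langle w,x_i\rangle-b)\ge1$ for all $i$. *Claim.* There are absolute constants $c,c'>0$ such that, for all $d\ge1$, $p\in(1,\infty]$, $r>0$, $\rho>20$ and $n\ge1$: 1. For every learning algorithm $A$ there is $D\in\mathcal F_{r,\rho}$ with $$\mathbb E_{S\sim D^n}\big[\mathcal L_r(A_S,D)\big]\ \ge\ c\,\min\{1,\,d/n\};$$ in particular the expected robust loss is at least $c\,d/n$ whenever $n\ge d$. 2. In contrast, for every $D\in\mathcal F_{r,\rho}$, the map $S\mapsto\mathcal L(M_S,D)$ is $D^n$-almost everywhere equal to a measurable function, and $$\mathbb E_{S\sim D^n}\big[\mathcal L(M_S,D)\big]\ \le\ c'\rho^2/n .$$ -/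

import Mathlib

open MeasureTheory Set
open scoped ENNReal

noncomputable section

namespace RobustLinear

/-- The instance space `ℝ^d`, with its Euclidean (`ℓ₂`) norm and inner product. -/
abbrev Pt (d : ℕ) : Type := EuclideanSpace ℝ (Fin d)

/-- The label set `{±1}`: `true` is the label `+1` and `false` is the label `-1`. -/
abbrev Label : Type := Bool

/-- The label as a real number. -/
def sgn (y : Label) : ℝ := if y then 1 else -1

/-- A labeled example. -/
abbrev Example (d : ℕ) : Type := Pt d × Label

/-- A classifier is an arbitrary map `ℝ^d → {±1}`. -/
abbrev Classifier (d : ℕ) : Type := Pt d → Label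

/-- The `ℓ_p` norm of a vector of `ℝ^d`, for `p ∈ [1, ∞]`. -/
def lpNorm {d : ℕ} (p : ℝ≥0∞) (x : Pt d) : ℝ := ‖WithLp.toLp p (WithLp.ofLp x)‖

/-- The closed `ℓ_p` ball `B_p(x, r)`. -/
def lpBall {d : ℕ} (p : ℝ≥0∞) (x : Pt d) (r : ℝ) : Set (Pt d) := {x' | lpNorm p (x' - x) ≤ r}

/-- The standard loss: the probability of `f x ≠ y`. -/
def stdLoss {d : ℕ} (f : Classifier d) (D : Measure (Example d)) : ℝ≥0∞ :=
  D {e | f e.1 ≠ e.2}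

/-- The robust loss at radius `r`: the probability that some `x' ∈ B_p(x, r)` has `f x' ≠ y`. -/
def robustLoss {d : ℕ} (p : ℝ≥0∞) (r : ℝ) (f : Classifier d) (D : Measure (Example d)) : ℝ≥0∞ :=
  D {e | ∃ x' ∈ lpBall p e.1 r, f x' ≠ e.2}

/-- A learning algorithm maps a training sample (of any size `n`) to a classifier, which need not
be linear. -/
abbrev LearningAlgorithm (d : ℕ) : Type := (n : ℕ) → (Fin n → Example d) → Classifier d

/-- The law `D^n` of a sample of `n` independent examples. -/
def sampleLaw {d : ℕ} (D : Measure (Example d)) (n : ℕ) : Measure (Fin n → Example d) :=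
  Measure.pi fun _ => D

/-- The expected standard loss of `A` trained on `n` examples. -/
def expStdLoss {d : ℕ} (A : LearningAlgorithm d) (n : ℕ) (D : Measure (Example d)) : ℝ≥0∞ :=
  ∫⁻ S, stdLoss (A n S) D ∂(sampleLaw D n)

/-- The expected robust loss of `A` trained on `n` examples. -/
def expRobustLoss {d : ℕ} (p : ℝ≥0∞) (r : ℝ) (A : LearningAlgorithm d) (n : ℕ)
    (D : Measure (Example d)) : ℝ≥0∞ :=
  ∫⁻ S, robustLoss p r (A n S) D ∂(sampleLaw D n)

open Classical in
/-- The linear classifier `f_{w,b}`, which is `+1` exactly where `⟨w, x⟩ ≥ b`. -/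
def linClassifier {d : ℕ} (w : Pt d) (b : ℝ) : Classifier d :=
  fun x => decide (b ≤ inner ℝ w x)

/-- `D` is linearly `r`-separable: some linear classifier has robust loss `0`. -/
def LinSeparable {d : ℕ} (p : ℝ≥0∞) (r : ℝ) (D : Measure (Example d)) : Prop :=
  ∃ (w : Pt d) (b : ℝ), robustLoss p r (linClassifier w b) D = 0

/-- The set `S⁺ ∪ S⁻` of all instances that occur, with either label, in the support of `D`. -/
def instances {d : ℕ} (D : Measure (Example d)) : Set (Pt d) := Prod.fst '' D.support

/-- `γ` is the margin of `D`: the largest real number for which some linear classifier `f_{w,b}`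
has standard loss `0` and a decision boundary `{z | ⟨w, z⟩ = b}` at `ℓ₂` distance at least `γ` from
every point of `S⁺ ∪ S⁻`. (If only one label occurs, there is no largest such number.) -/
def HasMargin {d : ℕ} (D : Measure (Example d)) (γ : ℝ) : Prop :=
  IsGreatest {g : ℝ | ∃ (w : Pt d) (b : ℝ), stdLoss (linClassifier w b) D = 0 ∧
    ∀ x ∈ instances D, ∀ z : Pt d, inner ℝ w z = b → g ≤ ‖x - z‖} γ

/-- `a` is the aspect ratio of `D`: the `ℓ₂` diameter of `S⁺ ∪ S⁻` over the margin. It takes values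
in `[0, ∞]`, so that an infinite diameter or a zero margin gives the value `∞`. -/
def HasAspectRatio {d : ℕ} (D : Measure (Example d)) (a : ℝ≥0∞) : Prop :=
  ∃ γ : ℝ, HasMargin D γ ∧ a = Metric.ediam (instances D) / ENNReal.ofReal γ

/-- The family `F_{r,ρ}` of all probability distributions over `ℝ^d × {±1}` that are linearly
`r`-separable (with respect to the `ℓ_p` norm) and have aspect ratio at most `ρ`. -/
def Family (d : ℕ) (p : ℝ≥0∞) (r ρ : ℝ) : Set (Measure (Example d)) :=
  {D | IsProbabilityMeasure D ∧ LinSeparable p r D ∧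
    ∃ a : ℝ≥0∞, HasAspectRatio D a ∧ a ≤ ENNReal.ofReal ρ}

/-- The constraints `y_i (⟨w, x_i⟩ - b) ≥ 1` of the hard-margin problem on the sample `S`. -/
def SVMFeasible {d n : ℕ} (S : Fin n → Example d) (w : Pt d) (b : ℝ) : Prop :=
  ∀ i, 1 ≤ sgn (S i).2 * (inner ℝ w (S i).1 - b)

/-- `(w, b)` solves the hard-margin problem: it minimizes `‖w‖₂` subject to the constraints.
If both labels occur in a separable sample, the solution is unique; if only one label occurs, the
solutions are `w = 0` and the `b` for which `f_{0,b}` constantly has that label. -/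
def SVMSolution {d n : ℕ} (S : Fin n → Example d) (w : Pt d) (b : ℝ) : Prop :=
  SVMFeasible S w b ∧ ∀ (w' : Pt d) (b' : ℝ), SVMFeasible S w' b' → ‖w‖ ≤ ‖w'‖

open Classical in
/-- The hard-margin SVM (max margin algorithm): it returns `f_{w,b}` for a solution `(w, b)` of the
hard-margin problem. On samples that are not linearly separable the problem is infeasible and the
output is immaterial. -/
def hardMarginSVM (d : ℕ) : LearningAlgorithm d := fun _ S =>
  if h : ∃ θ : Pt d × ℝ, SVMSolution S θ.1 θ.2 then linClassifier h.choose.1 h.choose.2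
  else fun _ => true

end RobustLinear

end

/-!
# Robust linear classification: a lower bound for all learners, an upper bound for the SVM

**The upper bound for the hard-margin SVM.** On a distribution of margin `γ` and diameter
`R ≤ ρ γ`, exchangeability (`prod_sampleLaw_apply`) turns `n + 1` times the expected loss into the
expected number of leave-one-out errors on `n + 1` examples. That number is at most
`R² ‖w‖² ≤ R² / γ² ≤ ρ²`, where `w` solves the hard-margin problem on the whole sample
(`card_leaveOneOut_errors_le`). The proof needs no Lagrange duality. If leaving out the `i`-th
example gives a solution `w_i` that errs on it, then `w_i` violates the left-out constraint by some
`ξ_i ≥ 1`, and `‖w - w_i‖ ≥ ξ_i / R`. As `w_i` solves a relaxed problem, `⟪w, w - w_i⟫ ≥ ‖w - w_i‖²`.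
On the other hand, an average of `w` and the `w_i`, with weights `ε / ξ_i`, satisfies all
constraints up to `ε`, and hence has a component along `w` of at least `(1 - ε) ‖w‖`. Comparing the
first-order terms in `ε` gives the bound. The loss is a measurable function of the sample because
the solution is unique when both labels occur, so that its graph is a Borel set with an injective
projection (`measurableSet_hardMarginSVM_eq_true`).

**The lower bound for robust learners.** Let `1` be the all-ones vector and `m • 1` the multiple of
`ℓ_p` norm `r`. For a sign pattern `s`, the distribution of pattern `s` has for each coordinate `j` a
light atom at `(m / 2) • e_j + s_j m • 1` with label `s_j`, and two heavy atoms at `± 2 m • 1`. Both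
possible balls around the `j`-th atom contain `(m / 2) • e_j`, so a classifier that has not seen the
`j`-th atom has to guess `s_j` there, and loses the mass of the atom with probability `1 / 2`
(`exists_pattern_le_expRobustLoss`). Each of these distributions is linearly `r`-separable: tilting
the functional `1` to `1 + η s` gains `(m / 2) η` at every light atom, whereas the maximum over the
`ℓ_p` ball exceeds the value at `m • 1` only by `o(η)`, since for `p > 1` the dual norm is
differentiable at `1` (`exists_tilt_bound`). The aspect ratio is at most `12`
(`map_hardAtom_mem_family`).
-/

namespace RobustLinear

variable {d n : ℕ}

/-! ### Solutions of the hard-margin problem -/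

lemma sgn_true : sgn true = 1 := rfl

lemma sgn_false : sgn false = -1 := rfl

lemma linClassifier_eq_true {w x : Pt d} {b : ℝ} :
    linClassifier w b x = true ↔ b ≤ inner ℝ w x := by
  simp [linClassifier]

lemma linClassifier_eq_false {w x : Pt d} {b : ℝ} :
    linClassifier w b x = false ↔ inner ℝ w x < b := by
  simp [linClassifier]

lemma linClassifier_eq_of_pos {w x : Pt d} {b : ℝ} {y : Label}
    (h : 0 < sgn y * (inner ℝ w x - b)) : linClassifier w b x = y := by
  cases y
  · rw [sgn_false] at h
    rw [linClassifier_eq_false]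
    linarith
  · rw [sgn_true] at h
    rw [linClassifier_eq_true]
    linarith

lemma sgn_mul_nonpos_of_ne {w x : Pt d} {b : ℝ} {y : Label}
    (h : linClassifier w b x ≠ y) : sgn y * (inner ℝ w x - b) ≤ 0 := by
  by_contra! hc
  exact h (linClassifier_eq_of_pos hc)

lemma exists_svmFeasible_iff (S : Fin n → Example d) (w : Pt d) :
    (∃ b, SVMFeasible S w b) ↔
      ∀ i j, (S i).2 = true → (S j).2 = false → 2 ≤ inner ℝ w ((S i).1 - (S j).1) := by
  constructor
  · rintro ⟨b, hb⟩ i j hi hj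
    have h1 := hb i
    have h2 := hb j
    rw [hi, sgn_true] at h1
    rw [hj, sgn_false] at h2
    rw [inner_sub_right]
    linarith
  · intro h
    suffices ∃ b : ℝ, (∀ i, (S i).2 = true → b ≤ inner ℝ w (S i).1 - 1) ∧
        ∀ j, (S j).2 = false → inner ℝ w (S j).1 + 1 ≤ b by
      obtain ⟨b, h1, h2⟩ := this
      refine ⟨b, fun i => ?_⟩
      cases hi : (S i).2
      · have := h2 i hi
        rw [sgn_false]
        linarith
      · have := h1 i hi
        rw [sgn_true]
        linarith
    by_cases hn : ∃ j, (S j).2 = false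
    · obtain ⟨j, hj, hmax⟩ := Set.exists_max_image {j | (S j).2 = false}
        (fun j => inner ℝ w (S j).1) (Set.toFinite _) hn
      refine ⟨inner ℝ w (S j).1 + 1, fun i hi => ?_, fun k hk => ?_⟩
      · have := h i j hi hj
        rw [inner_sub_right] at this
        linarith
      · have := hmax k hk
        linarith
    · by_cases hp : ∃ i, (S i).2 = true
      · obtain ⟨i, -, hmin⟩ := Set.exists_min_image {i | (S i).2 = true}
          (fun i => inner ℝ w (S i).1) (Set.toFinite _) hp
        refine ⟨inner ℝ w (S i).1 - 1, fun k hk => ?_, fun k hk => (hn ⟨k, hk⟩).elim⟩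
        have := hmin k hk
        linarith
      · exact ⟨0, fun k hk => (hp ⟨k, hk⟩).elim, fun k hk => (hn ⟨k, hk⟩).elim⟩

/-- A feasible hard-margin problem has a solution. The norm is not coercive in the bias, so the
minimum is taken over the closed set of those `w` that admit a bias. -/
lemma exists_svmSolution {S : Fin n → Example d} {w₀ : Pt d} {b₀ : ℝ}
    (h : SVMFeasible S w₀ b₀) : ∃ w b, SVMSolution S w b := by
  let K : Set (Pt d) := {w | ∃ b, SVMFeasible S w b}
  have hK : IsClosed K := by
    have : K = ⋂ i, ⋂ j, {w | (S i).2 = true → (S j).2 = false →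
        2 ≤ inner ℝ w ((S i).1 - (S j).1)} := by
      ext w
      simp only [K, Set.mem_ofPred_eq, exists_svmFeasible_iff, Set.mem_iInter]
    rw [this]
    refine isClosed_iInter fun i => isClosed_iInter fun j => ?_
    by_cases hi : (S i).2 = true
    · by_cases hj : (S j).2 = false
      · simp only [hi, hj, forall_const]
        exact isClosed_le continuous_const (by fun_prop)
      · simp [hj]
    · simp [hi]
  obtain ⟨w, ⟨b, hb⟩, hw⟩ := hK.exists_infDist_eq_dist ⟨w₀, b₀, h⟩ 0
  refine ⟨w, b, hb, fun w' b' h' => ?_⟩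
  have := Metric.infDist_le_dist_of_mem (x := (0 : Pt d)) (show w' ∈ K from ⟨b', h'⟩)
  rw [hw] at this
  simpa using this

lemma SVMFeasible.combo {S : Fin n → Example d} {w w' : Pt d} {b b' t : ℝ}
    (h : SVMFeasible S w b) (h' : SVMFeasible S w' b') (h0 : 0 ≤ t) (h1 : t ≤ 1) :
    SVMFeasible S (w + t • (w' - w)) (b + t * (b' - b)) := by
  intro i
  have e1 := mul_le_mul_of_nonneg_left (h i) (sub_nonneg.2 h1)
  have e2 := mul_le_mul_of_nonneg_left (h' i) h0
  rw [inner_add_left, real_inner_smul_left, inner_sub_left]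
  nlinarith

/-- The first-order optimality condition of the hard-margin problem. -/
lemma SVMSolution.inner_sub_nonneg {S : Fin n → Example d} {w w' : Pt d} {b b' : ℝ}
    (h : SVMSolution S w b) (h' : SVMFeasible S w' b') : 0 ≤ inner ℝ w (w' - w) := by
  by_contra! hneg
  set u := w' - w with hu
  have key : ∀ t : ℝ, 0 < t → t ≤ 1 → 0 ≤ 2 * inner ℝ w u + t * ‖u‖ ^ 2 := by
    intro t h0 h1
    have h2 := h.2 _ _ (h.1.combo h' h0.le h1)
    have h3 : ‖w‖ ^ 2 ≤ ‖w + t • u‖ ^ 2 := by gcongr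
    rw [norm_add_sq_real, real_inner_smul_right, norm_smul, mul_pow, Real.norm_eq_abs, sq_abs] at h3
    have : 0 ≤ t * (2 * inner ℝ w u + t * ‖u‖ ^ 2) := by nlinarith
    exact nonneg_of_mul_nonneg_right this h0
  have h4 := key 1 one_pos le_rfl
  have hu2 : 0 < ‖u‖ ^ 2 := by nlinarith
  have h5 := key (-inner ℝ w u / ‖u‖ ^ 2) (div_pos (neg_pos.2 hneg) hu2)
    (by rw [div_le_one hu2]; nlinarith)
  rw [div_mul_cancel₀ _ hu2.ne'] at h5
  linarith

lemma SVMSolution.normal_unique {S : Fin n → Example d} {w w' : Pt d} {b b' : ℝ}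
    (h : SVMSolution S w b) (h' : SVMSolution S w' b') : w = w' := by
  have h1 := h.inner_sub_nonneg h'.1
  have h2 := h'.inner_sub_nonneg h.1
  have : ‖w - w'‖ ^ 2 ≤ 0 := by
    rw [← real_inner_self_eq_norm_sq, inner_sub_left]
    rw [← neg_sub, inner_neg_right] at h1
    linarith
  have h3 : ‖w - w'‖ = 0 := by nlinarith [norm_nonneg (w - w')]
  exact sub_eq_zero.1 (norm_eq_zero.1 h3)

/-- If both labels occur, some constraint of either label is active at a solution: otherwise a
multiple of `w` by a factor below `1` would be feasible with another bias. -/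
lemma SVMSolution.exists_active {S : Fin n → Example d} {w : Pt d} {b : ℝ}
    (h : SVMSolution S w b) (hp : ∃ i, (S i).2 = true) (hn : ∃ j, (S j).2 = false) :
    ∃ i j, (S i).2 = true ∧ (S j).2 = false ∧
      inner ℝ w (S i).1 - b = 1 ∧ inner ℝ w (S j).1 - b = -1 := by
  obtain ⟨i, hi, hmin⟩ := Set.exists_min_image {i | (S i).2 = true}
    (fun i => inner ℝ w (S i).1) (Set.toFinite _) hp
  obtain ⟨j, hj, hmax⟩ := Set.exists_max_image {j | (S j).2 = false}
    (fun j => inner ℝ w (S j).1) (Set.toFinite _) hn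
  have h1 := h.1 i
  have h2 := h.1 j
  rw [show (S i).2 = true from hi, sgn_true] at h1
  rw [show (S j).2 = false from hj, sgn_false] at h2
  set a := inner ℝ w (S i).1 - inner ℝ w (S j).1 with ha
  have ha2 : 2 ≤ a := by linarith
  have hfeas : ∃ b', SVMFeasible S ((2 / a) • w) b' := by
    rw [exists_svmFeasible_iff]
    intro k l hk hl
    rw [real_inner_smul_left, inner_sub_right, div_mul_eq_mul_div, le_div_iff₀ (by linarith)]
    have := hmin k hk
    have := hmax l hl
    linarith
  obtain ⟨b', hb'⟩ := hfeas
  have h3 := h.2 _ _ hb'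
  have hw : 0 < ‖w‖ := by
    rw [norm_pos_iff]
    rintro rfl
    simp at ha
    linarith
  rw [norm_smul, Real.norm_of_nonneg (by positivity)] at h3
  have h4 : 1 ≤ 2 / a := by
    by_contra! hlt
    nlinarith
  rw [le_div_iff₀ (by linarith)] at h4
  exact ⟨i, j, hi, hj, by linarith, by linarith⟩

lemma SVMSolution.bias_unique {S : Fin n → Example d} {w : Pt d} {b b' : ℝ}
    (h : SVMSolution S w b) (h' : SVMSolution S w b')
    (hp : ∃ i, (S i).2 = true) (hn : ∃ j, (S j).2 = false) : b = b' := by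
  obtain ⟨i, j, hi, hj, h1, h2⟩ := h.exists_active hp hn
  have h3 := h'.1 i
  have h4 := h'.1 j
  rw [hi, sgn_true] at h3
  rw [hj, sgn_false] at h4
  linarith

lemma svmFeasible_zero {S : Fin n → Example d} {y : Label} (h : ∀ i, (S i).2 = y) :
    SVMFeasible S 0 (-sgn y) := by
  intro i
  rw [h i]
  cases y <;> simp [sgn]

lemma SVMSolution.eq_zero {S : Fin n → Example d} {w : Pt d} {b : ℝ} {y : Label}
    (h : SVMSolution S w b) (hy : ∀ i, (S i).2 = y) : w = 0 := by
  have := h.2 _ _ (svmFeasible_zero hy)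
  simpa using this

lemma hardMarginSVM_eq {S : Fin n → Example d} (h : ∃ w b, SVMSolution S w b) :
    ∃ w b, SVMSolution S w b ∧ hardMarginSVM d n S = linClassifier w b := by
  obtain ⟨w, b, h⟩ := h
  have h' : ∃ θ : Pt d × ℝ, SVMSolution S θ.1 θ.2 := ⟨(w, b), h⟩
  exact ⟨h'.choose.1, h'.choose.2, h'.choose_spec, by rw [hardMarginSVM, dif_pos h']⟩

lemma hardMarginSVM_eq_of_solution {S : Fin n → Example d} {w : Pt d} {b : ℝ}
    (h : SVMSolution S w b) (hp : ∃ i, (S i).2 = true) (hn : ∃ j, (S j).2 = false) :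
    hardMarginSVM d n S = linClassifier w b := by
  obtain ⟨w', b', h', he⟩ := hardMarginSVM_eq ⟨w, b, h⟩
  obtain rfl := h.normal_unique h'
  rw [he, h.bias_unique h' hp hn]

lemma hardMarginSVM_eq_const {S : Fin n → Example d} (hn : 0 < n) {y : Label}
    (hy : ∀ i, (S i).2 = y) (x : Pt d) : hardMarginSVM d n S x = y := by
  obtain ⟨w, b, h, he⟩ := hardMarginSVM_eq (exists_svmSolution (svmFeasible_zero hy))
  obtain rfl := h.eq_zero hy
  rw [he]
  have := h.1 ⟨0, hn⟩
  rw [hy] at this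
  refine linClassifier_eq_of_pos ?_
  simp only [inner_zero_left] at this ⊢
  linarith

/-! ### Leave-one-out errors -/

/-- A solution of the problem without the `i`-th example, when the hard-margin classifier
trained without that example errs on it: `ξ` is the amount by which `(w', b')` violates the
constraint of the `i`-th example, and it is bounded by the distance of the two solutions, since
`w - w'` increases by at least `ξ` between the `i`-th example and an active example of the other
label. -/
lemma exists_leaveOneOut_solution {S : Fin (n + 1) → Example d} (hn : 0 < n) {R : ℝ}
    (hR : ∀ i j, ‖(S i).1 - (S j).1‖ ≤ R) {w : Pt d} {b : ℝ} (h : SVMFeasible S w b)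
    {i : Fin (n + 1)}
    (herr : hardMarginSVM d n (fun j => S (i.succAbove j)) (S i).1 ≠ (S i).2) :
    ∃ (w' : Pt d) (b' ξ : ℝ), (∀ j, j ≠ i → 1 ≤ sgn (S j).2 * (inner ℝ w' (S j).1 - b')) ∧
      ξ = 1 - sgn (S i).2 * (inner ℝ w' (S i).1 - b') ∧ 1 ≤ ξ ∧
      0 ≤ inner ℝ w' (w - w') ∧ ξ ≤ R * ‖w - w'‖ := by
  set T : Fin n → Example d := fun j => S (i.succAbove j) with hT
  have hTf : SVMFeasible T w b := fun j => h (i.succAbove j)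
  -- it suffices to find an active constraint of the other label
  suffices ∃ (w' : Pt d) (b' : ℝ), SVMSolution T w' b' ∧
      sgn (S i).2 * (inner ℝ w' (S i).1 - b') ≤ 0 ∧ ∃ k, (S k).2 ≠ (S i).2 ∧
      sgn (S k).2 * (inner ℝ w' (S k).1 - b') = 1 by
    obtain ⟨w', b', hsol, hi, k, hk, hact⟩ := this
    refine ⟨w', b', _, fun j hj => ?_, rfl, by linarith, hsol.inner_sub_nonneg hTf, ?_⟩
    · obtain ⟨l, rfl⟩ := Fin.exists_succAbove_eq hj
      exact hsol.1 l
    · have h1 := h i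
      have h2 := h k
      have hcs := abs_real_inner_le_norm (w - w') ((S i).1 - (S k).1)
      have hle : ‖w - w'‖ * ‖(S i).1 - (S k).1‖ ≤ R * ‖w - w'‖ := by
        rw [mul_comm]
        exact mul_le_mul_of_nonneg_right (hR i k) (norm_nonneg _)
      have hab := abs_le.1 (hcs.trans hle)
      simp only [inner_sub_left, inner_sub_right] at hab
      cases hi' : (S i).2 <;> cases hk' : (S k).2 <;>
        simp only [hi', hk', sgn_true, sgn_false, ne_eq, not_true_eq_false] at * <;> linarith
  obtain ⟨j₀⟩ : Nonempty (Fin n) := ⟨⟨0, hn⟩⟩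
  by_cases hboth : (∃ j, (T j).2 = true) ∧ ∃ j, (T j).2 = false
  · obtain ⟨w', b', hsol, he⟩ := hardMarginSVM_eq (exists_svmSolution hTf)
    rw [he] at herr
    refine ⟨w', b', hsol, sgn_mul_nonpos_of_ne herr, ?_⟩
    obtain ⟨k, l, hk, hl, hk1, hl1⟩ := hsol.exists_active hboth.1 hboth.2
    cases hi : (S i).2
    · exact ⟨i.succAbove k, by simp [T] at hk; simp [hk],
        by simp only [T] at hk hk1; rw [hk, hk1, sgn_true]; norm_num⟩
    · exact ⟨i.succAbove l, by simp [T] at hl; simp [hl],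
        by simp only [T] at hl hl1; rw [hl, hl1, sgn_false]; norm_num⟩
  · -- only the label other than that of the `i`-th example remains
    have hsame : ∀ j, (T j).2 = (T j₀).2 := by
      intro j
      by_contra hne
      refine hboth ?_
      cases h1 : (T j).2 <;> cases h2 : (T j₀).2 <;> simp [h1, h2] at hne
      · exact ⟨⟨j₀, h2⟩, ⟨j, h1⟩⟩
      · exact ⟨⟨j, h1⟩, ⟨j₀, h2⟩⟩
    have hne : (T j₀).2 ≠ (S i).2 := by
      rw [hardMarginSVM_eq_const hn hsame] at herr
      exact herr
    refine ⟨0, -sgn (T j₀).2, ⟨svmFeasible_zero hsame, fun _ _ _ => by simp⟩, ?_,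
      i.succAbove j₀, hne, ?_⟩
    · cases h1 : (S i).2 <;> cases h2 : (T j₀).2 <;> simp [h1, h2] at hne <;> simp [sgn]
    · change sgn (T j₀).2 * _ = 1
      cases h2 : (T j₀).2 <;> simp [sgn]

open Classical in
/-- The leave-one-out bound. Let `w` solve the hard-margin problem on the whole sample, and let
`(w_i, b_i)` and `ξ_i` be the solution and the violation without the `i`-th example, for each `i`
at which an error occurs. Moving from `w` towards each `w_i` with weight `ε / ξ_i` violates every
constraint by at most `ε`, so optimality of `w` gives `∑ ⟪w, w - w_i⟫ / ξ_i ≤ ‖w‖²`. Each summand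
is at least `‖w - w_i‖² / ξ_i ≥ ξ_i / R² ≥ 1 / R²`. -/
lemma card_leaveOneOut_errors_le {S : Fin (n + 1) → Example d} (hn : 0 < n) {R : ℝ}
    (hR : ∀ i j, ‖(S i).1 - (S j).1‖ ≤ R) {w₀ : Pt d} {b₀ : ℝ} (h₀ : SVMFeasible S w₀ b₀) :
    ((Finset.univ.filter fun i : Fin (n + 1) =>
      hardMarginSVM d n (fun j => S (i.succAbove j)) (S i).1 ≠ (S i).2).card : ℝ)
      ≤ (R * ‖w₀‖) ^ 2 := by
  obtain ⟨w, b, h⟩ := exists_svmSolution h₀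
  set E := Finset.univ.filter fun i : Fin (n + 1) =>
      hardMarginSVM d n (fun j => S (i.succAbove j)) (S i).1 ≠ (S i).2 with hE
  have hR0 : 0 ≤ R := (norm_nonneg _).trans (hR 0 0)
  choose! W B ξ hfeas hξ h1 hopt hle using fun (i : Fin (n + 1)) (hi : i ∈ E) =>
    exists_leaveOneOut_solution hn hR h.1 (Finset.mem_filter.1 hi).2
  set ε : ℝ := 1 / (E.card + 2) with hε
  have hε0 : 0 < ε := by positivity
  have hε1 : ε < 1 := by
    rw [hε, div_lt_one (by positivity)]
    have : (0 : ℝ) ≤ E.card := by positivity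
    linarith
  set c : Fin (n + 1) → ℝ := fun i => ε / ξ i with hc
  have hc0 : ∀ i ∈ E, 0 ≤ c i := fun i hi => div_nonneg hε0.le (by linarith [h1 i hi])
  have hcξ : ∀ i ∈ E, c i * ξ i = ε := fun i hi =>
    div_mul_cancel₀ _ (by linarith [h1 i hi])
  have hcsum : ∑ i ∈ E, c i ≤ 1 := by
    calc ∑ i ∈ E, c i ≤ ∑ i ∈ E, ε := Finset.sum_le_sum fun i hi =>
          div_le_self hε0.le (h1 i hi)
      _ = E.card * ε := by rw [Finset.sum_const, nsmul_eq_mul]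
      _ ≤ 1 := by
          rw [hε, mul_one_div, div_le_one (by positivity)]
          linarith
  set u : Pt d := ∑ i ∈ E, c i • (W i - w) with hu
  set v : ℝ := ∑ i ∈ E, c i * (B i - b) with hv
  have hmix : ∀ j, 1 - ε ≤ sgn (S j).2 * (inner ℝ (w + u) (S j).1 - (b + v)) := by
    intro j
    set g : ℝ := sgn (S j).2 * (inner ℝ w (S j).1 - b) with hg
    set f : Fin (n + 1) → ℝ := fun i => sgn (S j).2 * (inner ℝ (W i) (S j).1 - B i) with hf
    have e1 : sgn (S j).2 * (inner ℝ (w + u) (S j).1 - (b + v)) =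
        g + ∑ i ∈ E, c i * (f i - g) := by
      have : ∑ i ∈ E, c i * (f i - g) = sgn (S j).2 * (inner ℝ u (S j).1 - v) := by
        rw [hu, hv, sum_inner, ← Finset.sum_sub_distrib, Finset.mul_sum]
        refine Finset.sum_congr rfl fun i _ => ?_
        rw [real_inner_smul_left, inner_sub_left]
        simp only [hf, hg]
        ring
      rw [this, inner_add_left, hg]
      ring
    have hg1 : 1 ≤ g := h.1 j
    have e2 : ∑ i ∈ E, c i * (f i - g) ≥ ∑ i ∈ E, (c i * (1 - g) - if i = j then ε else 0) := by
      refine Finset.sum_le_sum fun i hi => ?_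
      split_ifs with hij
      · subst hij
        have h3 : f i = 1 - ξ i := by rw [hξ i hi]; simp [hf]
        rw [h3]
        have := hcξ i hi
        linarith
      · have := mul_le_mul_of_nonneg_left (hfeas i hi j (Ne.symm hij)) (hc0 i hi)
        simp only [hf]
        linarith
    have e3 : ∑ i ∈ E, (if i = j then ε else 0) ≤ ε := by
      rw [Finset.sum_ite_eq']
      split_ifs
      · exact le_rfl
      · exact hε0.le
    rw [Finset.sum_sub_distrib, ← Finset.sum_mul] at e2
    rw [e1]
    nlinarith
  have hfeas' : SVMFeasible S ((1 - ε)⁻¹ • (w + u)) ((1 - ε)⁻¹ * (b + v)) := by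
    intro j
    have hpos : 0 < 1 - ε := by linarith
    rw [real_inner_smul_left, ← mul_sub, mul_left_comm, inv_mul_eq_div, le_div_iff₀ hpos, one_mul]
    exact hmix j
  have hfirst := h.inner_sub_nonneg hfeas'
  have hwu : -(ε * ‖w‖ ^ 2) ≤ inner ℝ w u := by
    have hpos : 0 < 1 - ε := by linarith
    rw [inner_sub_right, real_inner_smul_right, inner_add_right, real_inner_self_eq_norm_sq,
      inv_mul_eq_div, sub_nonneg, le_div_iff₀ hpos] at hfirst
    linarith
  have hterm : ∀ i ∈ E, ε ≤ R ^ 2 * (c i * inner ℝ w (w - W i)) := by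
    intro i hi
    have hin : ‖w - W i‖ ^ 2 ≤ inner ℝ w (w - W i) := by
      have := hopt i hi
      rw [← real_inner_self_eq_norm_sq, inner_sub_left]
      linarith
    have hsq : ξ i ^ 2 ≤ R ^ 2 * inner ℝ w (w - W i) := by
      calc ξ i ^ 2 ≤ (R * ‖w - W i‖) ^ 2 :=
            pow_le_pow_left₀ (by linarith [h1 i hi]) (hle i hi) 2
        _ = R ^ 2 * ‖w - W i‖ ^ 2 := by ring
        _ ≤ _ := mul_le_mul_of_nonneg_left hin (sq_nonneg R)
    calc ε = ε * 1 := (mul_one ε).symm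
      _ ≤ ε * ξ i := mul_le_mul_of_nonneg_left (h1 i hi) hε0.le
      _ = c i * ξ i ^ 2 := by rw [pow_two, ← mul_assoc, hcξ i hi]
      _ ≤ c i * (R ^ 2 * inner ℝ w (w - W i)) := mul_le_mul_of_nonneg_left hsq (hc0 i hi)
      _ = _ := by ring
  have hsum : E.card * ε ≤ R ^ 2 * (ε * ‖w‖ ^ 2) := by
    calc E.card * ε = ∑ i ∈ E, ε := by rw [Finset.sum_const, nsmul_eq_mul]
      _ ≤ ∑ i ∈ E, R ^ 2 * (c i * inner ℝ w (w - W i)) := Finset.sum_le_sum hterm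
      _ = R ^ 2 * -inner ℝ w u := by
          rw [← Finset.mul_sum, hu, inner_sum, ← Finset.sum_neg_distrib]
          congr 1
          refine Finset.sum_congr rfl fun i _ => ?_
          rw [real_inner_smul_right, ← neg_sub w, inner_neg_right]
          ring
      _ ≤ _ := mul_le_mul_of_nonneg_left (by linarith) (sq_nonneg R)
  have hcard : (E.card : ℝ) ≤ R ^ 2 * ‖w‖ ^ 2 := by
    refine le_of_mul_le_mul_right ?_ hε0
    linarith
  calc (E.card : ℝ) ≤ R ^ 2 * ‖w‖ ^ 2 := hcard
    _ = (R * ‖w‖) ^ 2 := by ring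
    _ ≤ (R * ‖w₀‖) ^ 2 := by
        have := h.2 _ _ h₀
        gcongr

/-! ### Measurability of the hard-margin SVM -/

lemma isClosed_svmFeasible :
    IsClosed {q : (Fin n → Example d) × (Pt d × ℝ) | SVMFeasible q.1 q.2.1 q.2.2} := by
  have hs : Continuous sgn := continuous_of_discreteTopology
  simp only [SVMFeasible, Set.ofPred_forall]
  exact isClosed_iInter fun i => isClosed_le continuous_const (by fun_prop)

/-- A feasible `(w', b')` with `‖w'‖ < ‖w‖` can be scaled up slightly, and then stays feasible for
nearby samples; hence optimality is a closed condition. -/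
lemma isClosed_svmOptimal :
    IsClosed {q : (Fin n → Example d) × (Pt d × ℝ) |
      ∀ w' b', SVMFeasible q.1 w' b' → ‖q.2.1‖ ≤ ‖w'‖} := by
  have hs : Continuous sgn := continuous_of_discreteTopology
  have : {q : (Fin n → Example d) × (Pt d × ℝ) |
      ∀ w' b', SVMFeasible q.1 w' b' → ‖q.2.1‖ ≤ ‖w'‖} =
      ⋂ w' : Pt d, ⋂ b' : ℝ, ({q | ∀ i, 1 < sgn (q.1 i).2 * (inner ℝ w' (q.1 i).1 - b')} ∩
        {q | ‖w'‖ < ‖q.2.1‖})ᶜ := by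
    ext q
    simp only [Set.mem_ofPred_eq, Set.mem_iInter, Set.mem_compl_iff, Set.mem_inter_iff, not_and,
      not_lt]
    refine ⟨fun h w' b' h' => h w' b' fun i => (h' i).le, fun h w' b' h' => ?_⟩
    by_contra! hlt
    obtain ⟨t, ht1, ht⟩ : ∃ t : ℝ, 1 < t ∧ t * ‖w'‖ < ‖q.2.1‖ := by
      have hc : ContinuousAt (fun t : ℝ => t * ‖w'‖) 1 := by fun_prop
      have he := hc.tendsto.eventually_lt_const (u := ‖q.2.1‖) (by simpa using hlt)
      obtain ⟨t, ht, ht'⟩ := ((he.filter_mono nhdsWithin_le_nhds).and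
        (self_mem_nhdsWithin (s := Set.Ioi (1 : ℝ)))).exists
      exact ⟨t, ht', ht⟩
    have h2 := h (t • w') (t * b') fun i => by
      rw [real_inner_smul_left, ← mul_sub, mul_left_comm]
      have := h' i
      nlinarith
    rw [norm_smul, Real.norm_of_nonneg (by linarith)] at h2
    linarith
  rw [this]
  refine isClosed_iInter fun w' => isClosed_iInter fun b' => IsOpen.isClosed_compl ?_
  refine IsOpen.inter ?_ (isOpen_lt continuous_const (by fun_prop))
  rw [Set.ofPred_forall]
  exact isOpen_iInter_of_finite fun i => isOpen_lt continuous_const (by fun_prop)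

lemma measurableSet_exists_label (y : Label) :
    MeasurableSet {S : Fin n → Example d | ∃ i, (S i).2 = y} := by
  rw [Set.ofPred_exists]
  exact MeasurableSet.iUnion fun i =>
    (measurable_snd.comp (measurable_pi_apply i)) (measurableSet_singleton y)

/-- The pairs of a sample with both labels and a solution of its hard-margin problem. -/
def solutionGraph (d n : ℕ) : Set ((Fin n → Example d) × (Pt d × ℝ)) :=
  {q | SVMSolution q.1 q.2.1 q.2.2 ∧ (∃ i, (q.1 i).2 = true) ∧ ∃ i, (q.1 i).2 = false}

lemma measurableSet_solutionGraph : MeasurableSet (solutionGraph d n) := by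
  have h : MeasurableSet {q : (Fin n → Example d) × (Pt d × ℝ) |
      SVMSolution q.1 q.2.1 q.2.2} :=
    (isClosed_svmFeasible.inter isClosed_svmOptimal).measurableSet
  exact h.inter ((measurable_fst (measurableSet_exists_label true)).inter
    (measurable_fst (measurableSet_exists_label false)))

lemma injOn_fst_solutionGraph : Set.InjOn Prod.fst (solutionGraph d n) := by
  rintro ⟨S, w, b⟩ ⟨h, hp, hn⟩ ⟨S', w', b'⟩ ⟨h', -, -⟩ rfl
  simp only at h h' hp hn
  obtain rfl := h.normal_unique h'
  rw [h.bias_unique h' hp hn]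

/-- The prediction of the hard-margin SVM is jointly measurable in the sample and the test point.
On samples with both labels the solution is unique, so its dependence on the sample is measurable
because an injective projection of a Borel set is Borel (the Lusin–Souslin theorem). -/
lemma measurableSet_hardMarginSVM_eq_true (hn : 0 < n) :
    MeasurableSet {q : (Fin n → Example d) × Pt d | hardMarginSVM d n q.1 q.2 = true} := by
  set P : Set (Fin n → Example d) := {S | ∃ i, (S i).2 = true} with hP
  set N : Set (Fin n → Example d) := {S | ∃ i, (S i).2 = false} with hN
  have hPm : MeasurableSet P := measurableSet_exists_label true
  have hNm : MeasurableSet N := measurableSet_exists_label false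
  set F : Set (Fin n → Example d) := Prod.fst '' solutionGraph d n with hF
  have hFm : MeasurableSet F :=
    measurableSet_solutionGraph.image_of_measurable_injOn measurable_fst injOn_fst_solutionGraph
  set G : Set (((Fin n → Example d) × (Pt d × ℝ)) × Pt d) :=
    {q | q.1 ∈ solutionGraph d n ∧ q.1.2.2 ≤ inner ℝ q.1.2.1 q.2} with hG
  have hGm : MeasurableSet G := by
    refine (measurable_fst measurableSet_solutionGraph).inter ?_
    exact (isClosed_le (f := fun q : ((Fin n → Example d) × (Pt d × ℝ)) × Pt d => q.1.2.2)
      (g := fun q => inner ℝ q.1.2.1 q.2) (by fun_prop) (by fun_prop)).measurableSet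
  set H : Set ((Fin n → Example d) × Pt d) := (fun q => (q.1.1, q.2)) '' G with hH
  have hHm : MeasurableSet H := by
    have : StandardBorelSpace (Fin n → Example d) := inferInstance
    have : MeasurableSpace.CountablySeparated ((Fin n → Example d) × Pt d) :=
      MeasurableSpace.countablySeparated_of_separatesPoints
    refine hGm.image_of_measurable_injOn (by fun_prop) ?_
    rintro ⟨q, x⟩ ⟨hq, -⟩ ⟨q', x'⟩ ⟨hq', -⟩ he
    simp only [Prod.mk.injEq] at he
    exact Prod.ext (injOn_fst_solutionGraph hq hq' he.1) he.2
  have hset : {q : (Fin n → Example d) × Pt d | hardMarginSVM d n q.1 q.2 = true} =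
      H ∪ Prod.fst ⁻¹' (P ∩ N ∩ Fᶜ) ∪ Prod.fst ⁻¹' (P ∩ Nᶜ) := by
    ext ⟨S, x⟩
    simp only [Set.mem_ofPred_eq, Set.mem_union, Set.mem_preimage]
    by_cases hp : S ∈ P
    · by_cases hn' : S ∈ N
      · by_cases hf : S ∈ F
        · obtain ⟨⟨S', w, b⟩, ⟨hsol, -, -⟩, rfl⟩ := hf
          simp only at hsol hp hn'
          rw [hardMarginSVM_eq_of_solution hsol hp hn', linClassifier_eq_true]
          have hf : S' ∈ F := ⟨(S', w, b), ⟨hsol, hp, hn'⟩, rfl⟩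
          simp only [Set.mem_inter_iff, Set.mem_compl_iff, hf, hn', not_true_eq_false, and_false,
            or_false]
          constructor
          · exact fun hx => ⟨((S', w, b), x), ⟨⟨hsol, hp, hn'⟩, hx⟩, rfl⟩
          · rintro ⟨⟨q, x'⟩, ⟨hq, hx⟩, he⟩
            simp only [Prod.mk.injEq] at he
            obtain ⟨he, rfl⟩ := he
            obtain rfl : q = (S', w, b) :=
              injOn_fst_solutionGraph hq (show (S', w, b) ∈ solutionGraph d n from
                ⟨hsol, hp, hn'⟩) he
            exact hx
        · have : hardMarginSVM d n S x = true := by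
            rw [hardMarginSVM, dif_neg]
            rintro ⟨θ, hθ⟩
            exact hf ⟨(S, θ), ⟨hθ, hp, hn'⟩, rfl⟩
          simp [this, hp, hn', hf]
      · have hall : ∀ i, (S i).2 = true := fun i => by
          by_contra hi
          exact hn' ⟨i, by simpa using hi⟩
        simp [hardMarginSVM_eq_const hn hall, hp, hn']
    · have hall : ∀ i, (S i).2 = false := fun i => by
        by_contra hi
        exact hp ⟨i, by simpa using hi⟩
      rw [hardMarginSVM_eq_const hn hall]
      simp only [Bool.false_eq_true, Set.mem_inter_iff, hp, false_and, or_false, false_iff]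
      rintro ⟨⟨q, x'⟩, ⟨hq, -⟩, he⟩
      simp only [Prod.mk.injEq] at he
      exact hp (he.1 ▸ hq.2.1)
  rw [hset]
  exact (hHm.union (measurable_fst ((hPm.inter hNm).inter hFm.compl))).union
    (measurable_fst (hPm.inter hNm.compl))

lemma measurableSet_hardMarginSVM_ne (hn : 0 < n) :
    MeasurableSet {q : (Fin n → Example d) × Example d |
      hardMarginSVM d n q.1 q.2.1 ≠ q.2.2} := by
  have h1 : Measurable fun q : (Fin n → Example d) × Pt d => hardMarginSVM d n q.1 q.2 :=
    measurable_to_bool (measurableSet_hardMarginSVM_eq_true hn)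
  have h2 : Measurable fun q : (Fin n → Example d) × Example d =>
      hardMarginSVM d n q.1 q.2.1 :=
    h1.comp (by fun_prop : Measurable fun q : (Fin n → Example d) × Example d => (q.1, q.2.1))
  exact (measurableSet_eq_fun h2 (by fun_prop)).compl

/-! ### Margins of distributions -/

/-- If `D` has a margin, a constant classifier has positive standard loss: otherwise every real
number would be a margin, witnessed by an empty decision boundary. -/
lemma HasMargin.stdLoss_const_ne_zero {D : Measure (Example d)} {γ : ℝ} (h : HasMargin D γ)
    (y : Label) : stdLoss (fun _ => y) D ≠ 0 := by
  intro h0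
  have hmem : γ + 1 ∈ {g : ℝ | ∃ (w : Pt d) (b : ℝ), stdLoss (linClassifier w b) D = 0 ∧
      ∀ x ∈ instances D, ∀ z : Pt d, inner ℝ w z = b → g ≤ ‖x - z‖} := by
    refine ⟨0, -sgn y, ?_, fun x _ z hz => ?_⟩
    · have : linClassifier (0 : Pt d) (-sgn y) = fun _ => y := by
        ext x : 1
        refine linClassifier_eq_of_pos ?_
        cases y <;> simp [sgn]
      rw [this, h0]
    · cases y <;> simp [sgn] at hz
  have := h.2 hmem
  linarith

lemma mul_inner_sub_nonneg_of_mem_support {D : Measure (Example d)} {w : Pt d} {b : ℝ}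
    (h : stdLoss (linClassifier w b) D = 0) {e : Example d} (he : e ∈ D.support) :
    0 ≤ sgn e.2 * (inner ℝ w e.1 - b) := by
  by_contra! hneg
  have hopen : IsOpen {e : Example d | sgn e.2 * (inner ℝ w e.1 - b) < 0} := by
    have hs : Continuous sgn := continuous_of_discreteTopology
    exact isOpen_lt (by fun_prop) continuous_const
  refine Measure.subset_compl_support_of_isOpen hopen (measure_mono_null (fun e he => ?_) h)
    hneg he
  intro heq
  have he' : sgn e.2 * (inner ℝ w e.1 - b) < 0 := he
  rcases hy : e.2 with _ | _
  · rw [hy, linClassifier_eq_false] at heq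
    rw [hy, sgn_false] at he'
    linarith
  · rw [hy, linClassifier_eq_true] at heq
    rw [hy, sgn_true] at he'
    linarith

/-- A bound on the distance from a point to a hyperplane, tested at the foot of the
perpendicular. -/
lemma mul_norm_le_abs_of_forall_le {w x : Pt d} {b g : ℝ} (hw : w ≠ 0)
    (h : ∀ z : Pt d, inner ℝ w z = b → g ≤ ‖x - z‖) : g * ‖w‖ ≤ |inner ℝ w x - b| := by
  have hpos : 0 < ‖w‖ := norm_pos_iff.2 hw
  have h1 := h (x - ((inner ℝ w x - b) / ‖w‖ ^ 2) • w) (by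
    rw [inner_sub_right, real_inner_smul_right, real_inner_self_eq_norm_sq,
      div_mul_cancel₀ _ (by positivity)]
    ring)
  rw [sub_sub_cancel, norm_smul, norm_div, Real.norm_eq_abs, norm_pow, norm_norm] at h1
  calc g * ‖w‖ ≤ |inner ℝ w x - b| / ‖w‖ ^ 2 * ‖w‖ * ‖w‖ :=
        mul_le_mul_of_nonneg_right h1 hpos.le
    _ = _ := by field_simp

lemma le_norm_sub_of_mul_norm_le_abs {w x z : Pt d} {b g : ℝ} (hw : w ≠ 0)
    (h : g * ‖w‖ ≤ |inner ℝ w x - b|) (hz : inner ℝ w z = b) : g ≤ ‖x - z‖ := by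
  have hpos : 0 < ‖w‖ := norm_pos_iff.2 hw
  rw [← hz, ← inner_sub_right] at h
  have := h.trans (abs_real_inner_le_norm _ _)
  rw [mul_comm] at this
  exact le_of_mul_le_mul_left this hpos

/-- Normalizing a linear classifier of positive margin `γ`: the hard-margin constraints hold on the
support with a normal vector of norm `1 / γ`. -/
lemma exists_normalized_of_margin {D : Measure (Example d)} {γ : ℝ} (hγ : 0 < γ) {w : Pt d} {b : ℝ}
    (hw : w ≠ 0) (hl : stdLoss (linClassifier w b) D = 0)
    (hm : ∀ x ∈ instances D, ∀ z : Pt d, inner ℝ w z = b → γ ≤ ‖x - z‖) :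
    ∃ (w' : Pt d) (b' : ℝ), ‖w'‖ = 1 / γ ∧
      ∀ e ∈ D.support, 1 ≤ sgn e.2 * (inner ℝ w' e.1 - b') := by
  have hpos : 0 < ‖w‖ := norm_pos_iff.2 hw
  have hk : 0 < γ * ‖w‖ := by positivity
  refine ⟨(γ * ‖w‖)⁻¹ • w, (γ * ‖w‖)⁻¹ * b, ?_, fun e he => ?_⟩
  · rw [norm_smul, Real.norm_of_nonneg (by positivity)]
    field_simp
  · have h1 := mul_norm_le_abs_of_forall_le hw (hm e.1 ⟨e, he, rfl⟩)
    have h2 := mul_inner_sub_nonneg_of_mem_support hl he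
    have h3 : |inner ℝ w e.1 - b| = sgn e.2 * (inner ℝ w e.1 - b) := by
      rw [← abs_of_nonneg h2, abs_mul]
      cases e.2 <;> simp [sgn]
    rw [real_inner_smul_left, ← mul_sub, mul_left_comm, inv_mul_eq_div, le_div_iff₀ hk, one_mul,
      ← h3]
    exact h1

lemma HasMargin.normal_ne_zero {D : Measure (Example d)} {γ : ℝ} (h : HasMargin D γ) {w : Pt d}
    {b : ℝ} (hl : stdLoss (linClassifier w b) D = 0) : w ≠ 0 := by
  rintro rfl
  refine h.stdLoss_const_ne_zero (linClassifier (0 : Pt d) b 0) ?_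
  have : linClassifier (0 : Pt d) b = fun _ => linClassifier (0 : Pt d) b 0 := by
    ext x : 1
    simp [linClassifier]
  rw [← this, hl]

lemma stdLoss_le_robustLoss {p : ℝ≥0∞} {r : ℝ} (hp : p ≠ 0) (hr : 0 ≤ r) (f : Classifier d)
    (D : Measure (Example d)) : stdLoss f D ≤ robustLoss p r f D := by
  refine measure_mono fun e he => ⟨e.1, ?_, he⟩
  simp only [lpBall, lpNorm, Set.mem_ofPred_eq, sub_self]
  suffices ‖WithLp.toLp p (0 : Fin d → ℝ)‖ ≤ r from this
  rcases eq_or_ne p ⊤ with rfl | htop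
  · rw [PiLp.norm_eq_ciSup]
    simpa using hr
  · have hp' := ENNReal.toReal_pos hp htop
    rw [PiLp.norm_eq_sum hp']
    simp [Real.zero_rpow hp'.ne', Real.zero_rpow (inv_pos.2 hp').ne', hr]

/-- In the family, the margin is positive and bounds the diameter, and the hard-margin constraints
are satisfiable on the whole support. The degenerate cases of the aspect ratio are excluded: a zero
margin forces a zero diameter, hence a constant label. -/
lemma exists_margin_of_mem_family {p : ℝ≥0∞} {r ρ : ℝ} (hp : 1 < p) (hr : 0 < r) (hρ : 0 ≤ ρ)
    {D : Measure (Example d)} (hD : D ∈ Family d p r ρ) :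
    ∃ γ : ℝ, 0 < γ ∧ (∀ x ∈ instances D, ∀ x' ∈ instances D, ‖x - x'‖ ≤ ρ * γ) ∧
      ∃ (w : Pt d) (b : ℝ), ‖w‖ = 1 / γ ∧
        ∀ e ∈ D.support, 1 ≤ sgn e.2 * (inner ℝ w e.1 - b) := by
  obtain ⟨hprob, ⟨w₁, b₁, h₁⟩, a, ⟨γ, hγ, rfl⟩, ha⟩ := hD
  have hl₁ : stdLoss (linClassifier w₁ b₁) D = 0 :=
    le_antisymm ((stdLoss_le_robustLoss (zero_lt_one.trans hp).ne' hr.le _ _).trans_eq h₁)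
      bot_le
  -- for `γ ≤ 0` the aspect ratio is `∞`, unless it is `0 / 0 = 0`
  have hpos : 0 < γ := by
    by_contra! hle
    rw [ENNReal.ofReal_of_nonpos hle] at ha
    have hdiam : Metric.ediam (instances D) = 0 := by
      by_contra hne
      rw [ENNReal.div_zero hne] at ha
      exact (ha.trans_lt ENNReal.ofReal_lt_top).ne rfl
    have hsub := Metric.ediam_eq_zero_iff.1 hdiam
    obtain ⟨e₀, he₀⟩ := Measure.nonempty_support (IsProbabilityMeasure.ne_zero D)
    refine hγ.stdLoss_const_ne_zero (linClassifier w₁ b₁ e₀.1) ?_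
    have hae : ∀ᵐ e ∂D, e ∈ D.support ∧ linClassifier w₁ b₁ e.1 = e.2 :=
      Filter.Eventually.and (Measure.support_mem_ae (μ := D))
        (by simpa [stdLoss, ae_iff] using hl₁)
    rw [stdLoss]
    change D {e | ¬ (linClassifier w₁ b₁ e₀.1 = e.2)} = 0
    rw [← ae_iff]
    filter_upwards [hae] with e he
    rw [← he.2, hsub ⟨e, he.1, rfl⟩ ⟨e₀, he₀, rfl⟩]
  obtain ⟨w, b, hl, hm⟩ := hγ.1
  refine ⟨γ, hpos, fun x hx x' hx' => ?_,
    exists_normalized_of_margin hpos (hγ.normal_ne_zero hl) hl hm⟩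
  have h0 : ENNReal.ofReal γ ≠ 0 := by simpa using hpos
  rw [ENNReal.div_le_iff h0 ENNReal.ofReal_ne_top] at ha
  have h1 := (Metric.edist_le_ediam_of_mem hx hx').trans ha
  rw [← ENNReal.ofReal_mul' hpos.le, edist_dist, dist_eq_norm] at h1
  exact (ENNReal.ofReal_le_ofReal_iff (by positivity)).1 h1

/-! ### The expected loss of the hard-margin SVM -/

/-- Exchangeability: testing on a fresh example is the same as testing on an example left out of a
sample of size `n + 1`, whichever one that is. -/
lemma prod_sampleLaw_apply (D : Measure (Example d)) [IsProbabilityMeasure D]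
    {E : Set ((Fin n → Example d) × Example d)} (hE : MeasurableSet E) (i : Fin (n + 1)) :
    (sampleLaw D n).prod D E =
      sampleLaw D (n + 1) {S | ((fun j => S (i.succAbove j)), S i) ∈ E} := by
  have h := measurePreserving_piFinSuccAbove (fun _ : Fin (n + 1) => D) i
  have h2 := (Measure.measurePreserving_swap (μ := D) (ν := Measure.pi fun _ : Fin n => D)).comp h
  exact (h2.measure_preimage hE.nullMeasurableSet).symm

lemma ae_sampleLaw_mem_support (D : Measure (Example d)) [IsProbabilityMeasure D] :
    ∀ᵐ S ∂(sampleLaw D n), ∀ i, S i ∈ D.support := by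
  rw [ae_all_iff]
  intro i
  exact (Measure.quasiMeasurePreserving_eval (fun _ : Fin n => D) i).ae Measure.support_mem_ae

/-- The hard-margin SVM on a distribution whose support has diameter at most `R` and satisfies the
hard-margin constraints for `(w, b)`. -/
lemma expStdLoss_hardMarginSVM_le {D : Measure (Example d)} [IsProbabilityMeasure D] (hn : 0 < n)
    {R : ℝ} (hR : ∀ x ∈ instances D, ∀ x' ∈ instances D, ‖x - x'‖ ≤ R) {w : Pt d} {b : ℝ}
    (hw : ∀ e ∈ D.support, 1 ≤ sgn e.2 * (inner ℝ w e.1 - b)) :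
    expStdLoss (hardMarginSVM d) n D ≤ ENNReal.ofReal ((R * ‖w‖) ^ 2 / n) := by
  classical
  set E : Set ((Fin n → Example d) × Example d) :=
    {q | hardMarginSVM d n q.1 q.2.1 ≠ q.2.2} with hEdef
  have hE : MeasurableSet E := measurableSet_hardMarginSVM_ne hn
  have : IsProbabilityMeasure (sampleLaw D n) := by unfold sampleLaw; infer_instance
  have : IsProbabilityMeasure (sampleLaw D (n + 1)) := by unfold sampleLaw; infer_instance
  have h1 : expStdLoss (hardMarginSVM d) n D = (sampleLaw D n).prod D E := by
    rw [Measure.prod_apply hE]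
    rfl
  set F : Fin (n + 1) → Set (Fin (n + 1) → Example d) :=
    fun i => {S | ((fun j => S (i.succAbove j)), S i) ∈ E} with hF
  have hFm : ∀ i, MeasurableSet (F i) := fun i =>
    (by fun_prop : Measurable fun S : Fin (n + 1) → Example d =>
      ((fun j => S (i.succAbove j)), S i)) hE
  have h2 : ((n + 1 : ℕ) : ℝ≥0∞) * (sampleLaw D n).prod D E ≤ ENNReal.ofReal ((R * ‖w‖) ^ 2) := by
    calc ((n + 1 : ℕ) : ℝ≥0∞) * (sampleLaw D n).prod D E
        = ∑ i, sampleLaw D (n + 1) (F i) := by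
          rw [Finset.sum_congr rfl fun i _ => (prod_sampleLaw_apply D hE i).symm]
          simp
      _ = ∫⁻ S, ∑ i, (F i).indicator 1 S ∂(sampleLaw D (n + 1)) := by
          rw [lintegral_finsetSum _ fun i _ => measurable_one.indicator (hFm i)]
          exact Finset.sum_congr rfl fun i _ => (lintegral_indicator_one (hFm i)).symm
      _ ≤ ∫⁻ _, ENNReal.ofReal ((R * ‖w‖) ^ 2) ∂(sampleLaw D (n + 1)) := by
          refine lintegral_mono_ae ?_
          filter_upwards [ae_sampleLaw_mem_support (n := n + 1) D] with S hS
          have h3 := card_leaveOneOut_errors_le (S := S) hn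
            (fun i j => hR _ ⟨_, hS i, rfl⟩ _ ⟨_, hS j, rfl⟩) (fun i => hw _ (hS i))
          have h4 : ∑ i, (F i).indicator (1 : (Fin (n + 1) → Example d) → ℝ≥0∞) S =
              ((Finset.univ.filter fun i : Fin (n + 1) =>
                hardMarginSVM d n (fun j => S (i.succAbove j)) (S i).1 ≠ (S i).2).card : ℝ≥0∞) := by
            simp only [Set.indicator_apply, Pi.one_apply, hF, hEdef, Set.mem_ofPred_eq,
              Finset.sum_boole]
          rw [h4, ← ENNReal.ofReal_natCast]
          exact ENNReal.ofReal_le_ofReal h3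
      _ = _ := by simp
  rw [h1, ENNReal.ofReal_div_of_pos (by positivity), ENNReal.ofReal_natCast,
    ENNReal.le_div_iff_mul_le (by simp [hn.ne']) (by simp), mul_comm]
  refine le_trans ?_ h2
  gcongr
  simp

lemma hardMarginSVM_upper_bound {p : ℝ≥0∞} {r ρ : ℝ} (hp : 1 < p) (hr : 0 < r) (hρ : 0 ≤ ρ)
    {D : Measure (Example d)} (hD : D ∈ Family d p r ρ) (hn : 0 < n) :
    Measurable (fun S => stdLoss (hardMarginSVM d n S) D) ∧
      expStdLoss (hardMarginSVM d) n D ≤ ENNReal.ofReal (ρ ^ 2 / n) := by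
  have := hD.1
  refine ⟨measurable_measure_prodMk_left (measurableSet_hardMarginSVM_ne hn), ?_⟩
  obtain ⟨γ, hγ, hdiam, w, b, hw, hfeas⟩ := exists_margin_of_mem_family hp hr hρ hD
  have h := expStdLoss_hardMarginSVM_le hn hdiam hfeas
  rwa [hw, mul_one_div, mul_div_cancel_right₀ _ hγ.ne'] at h

lemma abs_sgn (y : Label) : |sgn y| = 1 := by
  cases y <;> simp [sgn]

lemma sgn_mul_self (y : Label) : sgn y * sgn y = 1 := by
  cases y <;> simp [sgn]

/-! ### Tilted functionals on the `ℓ_p` ball -/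

lemma lpNorm_neg {p : ℝ≥0∞} (hp : 1 < p) (h : Pt d) : lpNorm p (-h) = lpNorm p h := by
  have : Fact (1 ≤ p) := ⟨hp.le⟩
  exact norm_neg (WithLp.toLp p (WithLp.ofLp h))

/-- The all-ones vector. -/
def ones (d : ℕ) : Pt d := WithLp.toLp 2 fun _ => 1

/-- The all-ones vector tilted by `η` in the direction of the sign pattern `s`. -/
def tilt (η : ℝ) (s : Fin d → Label) : Pt d := WithLp.toLp 2 fun j => 1 + η * sgn (s j)

lemma inner_tilt (η : ℝ) (s : Fin d → Label) (h : Pt d) :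
    inner ℝ (tilt η s) h = ∑ j, (1 + η * sgn (s j)) * h j := by
  simp [tilt, PiLp.inner_apply, mul_comm]

lemma inner_tilt_ones (η : ℝ) (s : Fin d → Label) :
    inner ℝ (tilt η s) (ones d) = ∑ j, (1 + η * sgn (s j)) := by
  simp [inner_tilt, ones]

lemma inner_tilt_single (η : ℝ) (s : Fin d → Label) (j : Fin d) :
    inner ℝ (tilt η s) (EuclideanSpace.single j 1) = 1 + η * sgn (s j) := by
  simp [inner_tilt]

lemma norm_ones_sq : ‖ones d‖ ^ 2 = d := by
  simp [EuclideanSpace.norm_sq_eq, ones]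

lemma norm_tilt_le {η : ℝ} (h0 : 0 ≤ η) (h1 : η ≤ 1 / 2) (s : Fin d → Label) :
    ‖tilt η s‖ ≤ 3 / 2 * ‖ones d‖ := by
  refine le_of_sq_le_sq ?_ (by positivity)
  rw [mul_pow, norm_ones_sq, EuclideanSpace.norm_sq_eq]
  calc ∑ j, ‖tilt η s j‖ ^ 2 ≤ ∑ _j : Fin d, (3 / 2 : ℝ) ^ 2 := by
        refine Finset.sum_le_sum fun j _ => ?_
        rw [Real.norm_eq_abs, sq_abs]
        have h : tilt η s j = 1 + η * sgn (s j) := rfl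
        rw [h]
        cases s j <;> simp only [sgn_true, sgn_false] <;> nlinarith
    _ = _ := by simp [mul_comm]

lemma le_inner_tilt_ones {η : ℝ} (h0 : 0 ≤ η) (h1 : η ≤ 1 / 4) (s : Fin d → Label) :
    3 / 4 * (d : ℝ) ≤ inner ℝ (tilt η s) (ones d) := by
  rw [inner_tilt_ones]
  calc 3 / 4 * (d : ℝ) = ∑ _j : Fin d, (3 / 4 : ℝ) := by simp [mul_comm]
    _ ≤ _ := by
        refine Finset.sum_le_sum fun j _ => ?_
        cases s j <;> simp only [sgn_true, sgn_false] <;> linarith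

lemma exists_rpow_one_add_le (q : ℝ) {ε : ℝ} (hε : 0 < ε) :
    ∃ δ : ℝ, 0 < δ ∧ ∀ t : ℝ, |t| ≤ δ → (1 + t) ^ q ≤ 1 + q * t + ε * |t| := by
  have h1 : HasDerivAt (fun t : ℝ => (1 + t) ^ q) q 0 := by
    have := ((hasDerivAt_id (0 : ℝ)).const_add 1).rpow_const (p := q) (by simp)
    simpa using this
  have h2 := (hasDerivAt_iff_isLittleO.1 h1).def hε
  obtain ⟨δ, hδ, hball⟩ := Metric.eventually_nhds_iff.1 h2
  refine ⟨δ / 2, by positivity, fun t ht => ?_⟩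
  have h3 := hball (y := t) (by rw [Real.dist_eq, sub_zero]; linarith)
  simp only [sub_zero, add_zero, Real.one_rpow, smul_eq_mul, Real.norm_eq_abs] at h3
  have := (abs_le.1 h3).2
  linarith

/-- Smoothness of the dual norm at the all-ones vector, which is where `1 < p` enters. For the
multiple `m • 1` on the `ℓ_p` sphere of radius `r`, the maximum of a tilted functional over the ball
exceeds its value at `m • 1` only by `o(η)`. -/
lemma exists_tilt_bound (hd : 0 < d) {p : ℝ≥0∞} (hp : 1 < p) {r : ℝ} (hr : 0 < r) :
    ∃ m : ℝ, 0 < m ∧ lpNorm p (m • ones d) ≤ r ∧ ∀ ε : ℝ, 0 < ε → ∃ η : ℝ, 0 < η ∧ η ≤ 1 / 4 ∧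
      ∀ (s : Fin d → Label) (h : Pt d), lpNorm p h ≤ r →
        inner ℝ (tilt η s) h ≤ m * inner ℝ (tilt η s) (ones d) + ε * η := by
  have : Nonempty (Fin d) := ⟨⟨0, hd⟩⟩
  have hd' : (0 : ℝ) < d := by exact_mod_cast hd
  rcases eq_or_ne p ⊤ with rfl | htop
  · refine ⟨r, hr, ?_, fun ε hε => ⟨1 / 4, by norm_num, le_rfl, fun s h hh => ?_⟩⟩
    · rw [lpNorm, PiLp.norm_eq_ciSup]
      simp [ones, abs_of_pos hr]
    · have hj : ∀ j, h j ≤ r := fun j => by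
        rw [lpNorm, PiLp.norm_eq_ciSup] at hh
        have := le_ciSup (f := fun i => ‖h i‖) (Set.finite_range _).bddAbove j
        exact (le_abs_self _).trans (this.trans hh)
      rw [inner_tilt, inner_tilt_ones, Finset.mul_sum]
      have : ∑ j, (1 + 1 / 4 * sgn (s j)) * h j ≤ ∑ j, r * (1 + 1 / 4 * sgn (s j)) := by
        refine Finset.sum_le_sum fun j _ => ?_
        rw [mul_comm]
        refine mul_le_mul_of_nonneg_right (hj j) ?_
        cases s j <;> simp only [sgn_true, sgn_false] <;> norm_num
      linarith
  · set P := p.toReal with hP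
    have hP1 : 1 < P := by
      rw [hP, ← ENNReal.toReal_one]
      exact (ENNReal.toReal_lt_toReal ENNReal.one_ne_top htop).2 hp
    have hP0 : 0 < P := by linarith
    have hnorm : ∀ h : Pt d, lpNorm p h = (∑ j, |h j| ^ P) ^ P⁻¹ := fun h => by
      rw [lpNorm, PiLp.norm_eq_sum (by rwa [← hP]), one_div]
      rfl
    -- `m` is chosen with `d * m ^ P = r ^ P`
    set m : ℝ := (r ^ P / d) ^ P⁻¹ with hm
    have hrP : 0 < r ^ P := Real.rpow_pos_of_pos hr P
    have hm0 : 0 < m := Real.rpow_pos_of_pos (by positivity) _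
    have hmP : m ^ P = r ^ P / d := Real.rpow_inv_rpow (by positivity) hP0.ne'
    obtain ⟨q, hq⟩ : ∃ q, P.HolderConjugate q := ⟨_, Real.HolderConjugate.conjExponent hP1⟩
    refine ⟨m, hm0, ?_, fun ε hε => ?_⟩
    · rw [hnorm, Real.rpow_inv_le_iff_of_pos (by positivity) hr.le hP0]
      have : ∀ j, |(m • ones d) j| ^ P = r ^ P / d := fun j => by
        rw [← hmP]
        simp [ones, abs_of_pos hm0]
      rw [Finset.sum_congr rfl fun j _ => this j]
      simp only [Finset.sum_const, Finset.card_univ, Fintype.card_fin, nsmul_eq_mul]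
      rw [mul_div_cancel₀ _ hd'.ne']
    · have hq0 : 0 < q := hq.symm.pos
      set ε' : ℝ := ε * q / (m * d) with hε'
      obtain ⟨δ, hδ, hδ'⟩ := exists_rpow_one_add_le q (ε := ε') (by positivity)
      refine ⟨min δ (1 / 4), by positivity, min_le_right _ _, fun s h hh => ?_⟩
      set η := min δ (1 / 4) with hη
      have hη0 : 0 < η := by positivity
      have hη1 : η ≤ 1 / 4 := min_le_right _ _
      rw [hnorm, Real.rpow_inv_le_iff_of_pos (by positivity) hr.le hP0] at hh
      -- Young's inequality for `h j / m` and the `j`-th entry of `tilt η s` is an equality to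
      -- first order at `h = m • 1`
      have hterm : ∀ j, (1 + η * sgn (s j)) * h j ≤
          m * (|h j| ^ P / m ^ P / P + (1 + q * (η * sgn (s j)) + ε' * η) / q) := by
        intro j
        have hpos : 0 ≤ 1 + η * sgn (s j) := by
          cases s j <;> simp only [sgn_true, sgn_false] <;> linarith
        have hy := Real.young_inequality (h j / m) (1 + η * sgn (s j)) hq
        rw [abs_div, abs_of_pos hm0, Real.div_rpow (abs_nonneg _) hm0.le, abs_of_nonneg hpos] at hy
        have habs : |η * sgn (s j)| = η := by rw [abs_mul, abs_sgn, abs_of_pos hη0, mul_one]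
        have h2 := hδ' (η * sgn (s j)) (by rw [habs]; exact min_le_left _ _)
        rw [habs] at h2
        calc (1 + η * sgn (s j)) * h j = m * (h j / m * (1 + η * sgn (s j))) := by
              field_simp
          _ ≤ m * (|h j| ^ P / m ^ P / P + (1 + η * sgn (s j)) ^ q / q) :=
              mul_le_mul_of_nonneg_left hy hm0.le
          _ ≤ _ := by gcongr
      have hsum : ∑ j, |h j| ^ P / m ^ P / P ≤ d / P := by
        rw [← Finset.sum_div, ← Finset.sum_div, hmP]
        gcongr
        rw [div_le_iff₀ (by positivity), mul_div_cancel₀ _ hd'.ne']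
        exact hh
      have hinv := hq.inv_add_inv_eq_one
      rw [inner_tilt, inner_tilt_ones]
      calc ∑ j, (1 + η * sgn (s j)) * h j
          ≤ ∑ j, m * (|h j| ^ P / m ^ P / P + (1 + q * (η * sgn (s j)) + ε' * η) / q) :=
            Finset.sum_le_sum fun j _ => hterm j
        _ = m * (∑ j, |h j| ^ P / m ^ P / P +
              ∑ j, (1 + q * (η * sgn (s j)) + ε' * η) / q) := by
            rw [← Finset.mul_sum, Finset.sum_add_distrib]
        _ ≤ m * (d / P + ∑ j, (1 + q * (η * sgn (s j)) + ε' * η) / q) := by gcongr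
        _ = m * (d / P + (d / q + ∑ j, η * sgn (s j) + d * (ε' * η / q))) := by
            have : ∀ j, (1 + q * (η * sgn (s j)) + ε' * η) / q =
                1 / q + η * sgn (s j) + ε' * η / q := fun j => by field_simp
            rw [Finset.sum_congr rfl fun j _ => this j, Finset.sum_add_distrib,
              Finset.sum_add_distrib]
            simp [div_eq_mul_inv]
        _ = m * (d * (P⁻¹ + q⁻¹) + ∑ j, η * sgn (s j)) + m * (d * (ε' * η / q)) := by ring
        _ = m * ∑ j, (1 + η * sgn (s j)) + ε * η := by
            rw [hinv, Finset.sum_add_distrib]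
            have : m * (d * (ε' * η / q)) = ε * η := by
              rw [hε']
              field_simp
            rw [this]
            simp

/-! ### The hard distributions -/

/-- A finitely supported distribution with both labels that satisfies the hard-margin constraints
has a margin: the reciprocal of the norm of the solution of the hard-margin problem on its
atoms. -/
lemma exists_hasMargin_of_range {k : ℕ} {S : Fin k → Example d} {D : Measure (Example d)}
    (hnull : D (Set.range S)ᶜ = 0) (hatom : ∀ i, D {S i} ≠ 0)
    (hpos : ∃ i, (S i).2 = true) (hneg : ∃ i, (S i).2 = false)
    {w₀ : Pt d} {b₀ : ℝ} (h₀ : SVMFeasible S w₀ b₀) :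
    D.support ⊆ Set.range S ∧ ∃ γ, HasMargin D γ ∧ 0 < γ ∧ 1 ≤ γ * ‖w₀‖ := by
  have hsub : D.support ⊆ Set.range S :=
    Measure.support_subset_of_isClosed (Set.finite_range S).isClosed hnull
  have hsup : ∀ i, S i ∈ D.support := fun i => by
    rw [Measure.mem_support_iff_forall]
    exact fun U hU => (pos_iff_ne_zero.2 (hatom i)).trans_le
      (measure_mono (Set.singleton_subset_iff.2 (mem_of_mem_nhds hU)))
  obtain ⟨w, b, h⟩ := exists_svmSolution h₀
  have hw : w ≠ 0 := by
    rintro rfl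
    obtain ⟨i, hi⟩ := hpos
    obtain ⟨j, hj⟩ := hneg
    have h1 := h.1 i
    have h2 := h.1 j
    rw [hi, sgn_true, inner_zero_left] at h1
    rw [hj, sgn_false, inner_zero_left] at h2
    linarith
  have hw' : 0 < ‖w‖ := norm_pos_iff.2 hw
  refine ⟨hsub, 1 / ‖w‖, ⟨⟨w, b, ?_, ?_⟩, ?_⟩, by positivity, ?_⟩
  · refine measure_mono_null (fun e he => ?_) hnull
    rintro ⟨i, rfl⟩
    exact he (linClassifier_eq_of_pos (zero_lt_one.trans_le (h.1 i)))
  · rintro x ⟨e, he, rfl⟩ z hz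
    obtain ⟨i, rfl⟩ := hsub he
    refine le_norm_sub_of_mul_norm_le_abs hw ?_ hz
    rw [one_div_mul_cancel hw'.ne']
    have := (h.1 i).trans (le_abs_self _)
    rwa [abs_mul, abs_sgn, one_mul] at this
  · rintro g ⟨w', b', hl, hm⟩
    rcases le_or_gt g 0 with hg | hg
    · exact hg.trans (by positivity)
    have hw'0 : w' ≠ 0 := by
      rintro rfl
      obtain ⟨i, hi⟩ := hpos
      obtain ⟨j, hj⟩ := hneg
      have h1 := mul_inner_sub_nonneg_of_mem_support hl (hsup i)
      have h2 := mul_inner_sub_nonneg_of_mem_support hl (hsup j)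
      rw [hi, sgn_true, inner_zero_left] at h1
      rw [hj, sgn_false, inner_zero_left] at h2
      have h3 := hm _ ⟨_, hsup i, rfl⟩ (S i).1 (by rw [inner_zero_left]; linarith)
      rw [sub_self, norm_zero] at h3
      linarith
    obtain ⟨w'', b'', hn, hf⟩ := exists_normalized_of_margin hg hw'0 hl hm
    have := h.2 w'' b'' fun i => hf _ (hsup i)
    rw [hn, le_div_iff₀ hg] at this
    rw [le_div_iff₀ hw']
    linarith
  · rw [one_div_mul_eq_div, one_le_div hw']
    exact h.2 _ _ h₀

instance {α β : Type*} [MeasurableSpace α] [MeasurableSpace β] [MeasurableSingletonClass α]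
    [MeasurableSingletonClass β] : MeasurableSingletonClass (α ⊕ β) where
  measurableSet_singleton
    | Sum.inl a => by
      rw [← Set.image_singleton]
      exact measurableSet_inl_image.2 (measurableSet_singleton a)
    | Sum.inr b => by
      rw [← Set.image_singleton]
      exact measurableSet_inr_image.2 (measurableSet_singleton b)

/-- The atoms of the hard distribution with sign pattern `s`. The atom `inl j` sits at
`L • e_j ± m • 1` on the side given by its label `s j`, so that both of its possible positions have
`L • e_j` in their `ℓ_p` ball; the atoms `inr ±` are independent of `s`. -/
noncomputable def hardAtom (L m : ℝ) (s : Fin d → Label) : Fin d ⊕ Label → Example d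
  | Sum.inl j => (L • EuclideanSpace.single j 1 + (sgn (s j) * m) • ones d, s j)
  | Sum.inr y => ((sgn y * (2 * m)) • ones d, y)

lemma hardAtom_injective {m : ℝ} (hm : 0 < m) (s : Fin d → Label) :
    Function.Injective (hardAtom (m / 2) m s) := by
  have hmixed : ∀ j y, hardAtom (m / 2) m s (Sum.inl j) ≠ hardAtom (m / 2) m s (Sum.inr y) := by
    intro j y h
    simp only [hardAtom, Prod.mk.injEq] at h
    obtain ⟨h1, rfl⟩ := h
    have h2 := congrArg (fun v : Pt d => v j) h1
    simp only [ones, PiLp.add_apply, PiLp.smul_apply, PiLp.single_apply, if_true,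
      smul_eq_mul, mul_one] at h2
    cases hs : s j <;> rw [hs] at h2 <;> simp only [sgn_true, sgn_false] at h2 <;> linarith
  rintro (j | y) (k | z) h
  · simp only [hardAtom, Prod.mk.injEq] at h
    obtain ⟨h1, h2⟩ := h
    rw [h2, add_left_inj] at h1
    have h3 := congrArg (fun v : Pt d => v j) h1
    simp only [PiLp.smul_apply, PiLp.single_apply, if_true, smul_eq_mul,
      mul_one] at h3
    split_ifs at h3 with hjk
    · rw [hjk]
    · linarith
  · exact (hmixed j z h).elim
  · exact (hmixed k y h.symm).elim
  · simp only [hardAtom, Prod.mk.injEq] at h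
    rw [h.2]

lemma norm_hardAtom_le (hd : 0 < d) {m : ℝ} (hm : 0 < m) (s : Fin d → Label)
    (i : Fin d ⊕ Label) : ‖(hardAtom (m / 2) m s i).1‖ ≤ 2 * m * ‖ones d‖ := by
  have h1 : 1 ≤ ‖ones d‖ := by
    have h2 : (1 : ℝ) ≤ ‖ones d‖ ^ 2 := by rw [norm_ones_sq]; exact_mod_cast hd
    nlinarith [norm_nonneg (ones d)]
  have hmK : m ≤ m * ‖ones d‖ := le_mul_of_one_le_right hm.le h1
  rcases i with j | y
  · simp only [hardAtom]
    refine (norm_add_le _ _).trans ?_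
    rw [norm_smul, norm_smul, Real.norm_eq_abs, Real.norm_eq_abs, abs_mul, abs_sgn,
      abs_of_pos hm, abs_of_pos (half_pos hm), PiLp.norm_single]
    norm_num
    linarith
  · simp only [hardAtom]
    rw [norm_smul, Real.norm_eq_abs, abs_mul, abs_sgn, one_mul, abs_of_pos (by positivity)]

/-- The signed distance (up to normalization) of the atoms from the tilted hyperplane
`⟪tilt η s, z⟫ = m / 2`. The tilt moves the hyperplane away from `(m / 2) • e_j` to the side
opposite to the label `s j`. -/
lemma le_sgn_mul_inner_tilt_hardAtom (hd : 0 < d) {m η : ℝ} (hm : 0 < m) (h0 : 0 < η)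
    (h1 : η ≤ 1 / 4) (s : Fin d → Label) (i : Fin d ⊕ Label) :
    m * inner ℝ (tilt η s) (ones d) + m / 2 * η ≤
      sgn (hardAtom (m / 2) m s i).2 *
        (inner ℝ (tilt η s) (hardAtom (m / 2) m s i).1 - m / 2) := by
  have hW := le_inner_tilt_ones h0.le h1 s
  have hd1 : (1 : ℝ) ≤ d := by exact_mod_cast hd
  rcases i with j | y
  · simp only [hardAtom]
    rw [inner_add_right, real_inner_smul_right, real_inner_smul_right, inner_tilt_single]
    have := sgn_mul_self (s j)
    refine le_of_eq ?_
    linear_combination (-(m * inner ℝ (tilt η s) (ones d)) - m / 2 * η) * this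
  · simp only [hardAtom]
    rw [real_inner_smul_right]
    have hmW : m * (3 / 4) ≤ m * inner ℝ (tilt η s) (ones d) :=
      mul_le_mul_of_nonneg_left (by linarith) hm.le
    have : m / 2 * η ≤ m / 2 * (1 / 4) := by gcongr
    cases y <;> simp only [sgn_true, sgn_false] <;> linarith

/-- The hard distribution belongs to the family. Its aspect ratio is at most `12`. -/
lemma map_hardAtom_mem_family (hd : 0 < d) {p : ℝ≥0∞} (hp : 1 < p) {r ρ : ℝ} (hρ : 12 ≤ ρ)
    {m η : ℝ} (hm : 0 < m) (h0 : 0 < η) (h1 : η ≤ 1 / 4) (s : Fin d → Label)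
    (hη : ∀ h : Pt d, lpNorm p h ≤ r →
      inner ℝ (tilt η s) h ≤ m * inner ℝ (tilt η s) (ones d) + m / 4 * η)
    (μ : Measure (Fin d ⊕ Label)) [IsProbabilityMeasure μ] (hμ : ∀ i, μ {i} ≠ 0) :
    μ.map (hardAtom (m / 2) m s) ∈ Family d p r ρ := by
  set φ := hardAtom (m / 2) m s with hφ
  have hmeas : Measurable φ := measurable_of_countable φ
  have hd' : (0 : ℝ) < d := by exact_mod_cast hd
  have hnull : μ.map φ (Set.range φ)ᶜ = 0 := by
    rw [Measure.map_apply hmeas (Set.finite_range φ).measurableSet.compl]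
    simp
  have hatom : ∀ i, μ.map φ {φ i} ≠ 0 := fun i => by
    rw [Measure.map_apply hmeas (measurableSet_singleton _)]
    intro hc
    exact hμ i (measure_mono_null (by simp) hc)
  -- in signed value the atoms exceed the threshold by `m ⟪tilt η s, 1⟫ + (m / 2) η` at least, and
  -- moving by `r` in the `ℓ_p` norm costs at most `m ⟪tilt η s, 1⟫ + (m / 4) η`
  refine ⟨Measure.isProbabilityMeasure_map hmeas.aemeasurable, ⟨tilt η s, m / 2, ?_⟩, ?_⟩
  · refine measure_mono_null (fun e he => ?_) hnull
    rintro ⟨i, rfl⟩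
    obtain ⟨x', hx', hne⟩ := he
    refine hne (linClassifier_eq_of_pos ?_)
    have ha := le_sgn_mul_inner_tilt_hardAtom hd hm h0 h1 s i
    have hb := hη _ hx'
    have hc := hη (-(x' - (φ i).1)) (by rw [lpNorm_neg hp]; exact hx')
    rw [inner_neg_right] at hc
    rw [inner_sub_right] at hb hc
    have hpos : 0 < m * η := by positivity
    rw [← hφ] at ha
    cases hy : (φ i).2 <;> rw [hy] at ha <;> simp only [sgn_true, sgn_false] at ha ⊢ <;> linarith
  · let e := Fintype.equivFin (Fin d ⊕ Label)
    set S : Fin (Fintype.card (Fin d ⊕ Label)) → Example d := fun k => φ (e.symm k) with hS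
    have hrange : Set.range S = Set.range φ := e.symm.surjective.range_comp φ
    have hk : 0 < m * d / 2 := by positivity
    -- `⟪tilt η s, 1⟫ ≥ 3 d / 4`, so all atoms are at level at least `m d / 2`
    have hfeas : SVMFeasible S ((m * d / 2)⁻¹ • tilt η s) ((m * d / 2)⁻¹ * (m / 2)) := by
      intro k
      rw [real_inner_smul_left, ← mul_sub, mul_left_comm, inv_mul_eq_div, le_div_iff₀ hk, one_mul]
      refine le_trans ?_ (le_sgn_mul_inner_tilt_hardAtom hd hm h0 h1 s (e.symm k))
      have hW := le_inner_tilt_ones h0.le h1 s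
      have : m * (3 / 4 * d) ≤ m * inner ℝ (tilt η s) (ones d) :=
        mul_le_mul_of_nonneg_left hW hm.le
      have : 0 < m * η := by positivity
      have : 0 < m * d := by positivity
      linarith
    obtain ⟨hsub, γ, hγ, hγ0, hle⟩ := exists_hasMargin_of_range (S := S) (by rwa [hrange])
      (fun k => hatom _) ⟨e (Sum.inr true), by simp [S, φ, hardAtom]⟩
      ⟨e (Sum.inr false), by simp [S, φ, hardAtom]⟩ hfeas
    refine ⟨_, ⟨γ, hγ, rfl⟩, ?_⟩
    rw [ENNReal.div_le_iff (by simpa using hγ0) ENNReal.ofReal_ne_top,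
      ← ENNReal.ofReal_mul (by linarith)]
    refine Metric.ediam_le ?_
    rintro _ ⟨a, ha, rfl⟩ _ ⟨a', ha', rfl⟩
    obtain ⟨k, rfl⟩ := hsub ha
    obtain ⟨k', rfl⟩ := hsub ha'
    rw [edist_dist, dist_eq_norm]
    refine ENNReal.ofReal_le_ofReal ?_
    have hK := norm_ones_sq (d := d)
    have hN : ‖(m * d / 2)⁻¹ • tilt η s‖ ≤ (m * d / 2)⁻¹ * (3 / 2 * ‖ones d‖) := by
      rw [norm_smul, Real.norm_of_nonneg (by positivity)]
      have := norm_tilt_le h0.le (by linarith) s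
      gcongr
    have h2 : 1 ≤ γ * ((m * d / 2)⁻¹ * (3 / 2 * ‖ones d‖)) :=
      hle.trans (mul_le_mul_of_nonneg_left hN hγ0.le)
    have h3 : m * d ≤ 3 * γ * ‖ones d‖ := by
      have h4 : γ * ((m * d / 2)⁻¹ * (3 / 2 * ‖ones d‖)) = 3 * γ * ‖ones d‖ / (m * d) := by
        field_simp
      rw [h4, le_div_iff₀ (by positivity)] at h2
      linarith
    have hKpos : 0 < ‖ones d‖ := by
      refine lt_of_le_of_ne (norm_nonneg _) fun hz => ?_
      rw [← hz] at hK
      simp at hK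
      linarith
    have h5 : m * ‖ones d‖ ≤ 3 * γ := by
      rw [← hK] at h3
      refine le_of_mul_le_mul_right ?_ hKpos
      linarith
    calc ‖(S k).1 - (S k').1‖ ≤ ‖(S k).1‖ + ‖(S k').1‖ := norm_sub_le _ _
      _ ≤ 2 * m * ‖ones d‖ + 2 * m * ‖ones d‖ :=
          add_le_add (norm_hardAtom_le hd hm s _) (norm_hardAtom_le hd hm s _)
      _ ≤ 12 * γ := by linarith
      _ ≤ ρ * γ := by gcongr

/-- Weights for the atoms: mass `q` on each `inl j`, the rest evenly on the two atoms `inr ±`. -/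
lemma exists_atomMeasure {q : ℝ} (hq : 0 < q) (hdq : d * q ≤ 1 / 2) :
    ∃ μ : Measure (Fin d ⊕ Label), IsProbabilityMeasure μ ∧
      (∀ j, μ {Sum.inl j} = ENNReal.ofReal q) ∧ ∀ i, μ {i} ≠ 0 := by
  have hsum : ∑ i : Fin d ⊕ Label, Sum.elim (fun _ => ENNReal.ofReal q)
      (fun _ => ENNReal.ofReal ((1 - d * q) / 2)) i = 1 := by
    rw [Fintype.sum_sum_type]
    simp only [Sum.elim_inl, Sum.elim_inr, Finset.sum_const, Finset.card_univ, Fintype.card_fin,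
      Fintype.card_bool, nsmul_eq_mul]
    rw [← ENNReal.ofReal_natCast, ← ENNReal.ofReal_natCast, ← ENNReal.ofReal_mul (by positivity),
      ← ENNReal.ofReal_mul (by positivity), ← ENNReal.ofReal_add (by positivity)
        (mul_nonneg (by positivity) (by linarith)), ← ENNReal.ofReal_one]
    congr 1
    push_cast
    ring
  refine ⟨(PMF.ofFintype _ hsum).toMeasure, inferInstance, fun j => ?_, fun i => ?_⟩
  · rw [PMF.toMeasure_apply_singleton _ _ (measurableSet_singleton _)]
    rfl
  · rw [PMF.toMeasure_apply_singleton _ _ (measurableSet_singleton _), PMF.ofFintype_apply]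
    rcases i with j | y
    · simpa using hq
    · simp only [Sum.elim_inr, ne_eq, ENNReal.ofReal_eq_zero, not_le]
      linarith

/-! ### The expected robust loss of an arbitrary learner -/

/-- A guess of `s j` that does not depend on `s j` is wrong for half of the patterns `s`. -/
lemma two_mul_sum_indicator_ne (j : Fin d) (g : (Fin d → Label) → Label)
    (hg : ∀ s, g (Function.update s j (!s j)) = g s) :
    2 * ∑ s : Fin d → Label, (if g s ≠ s j then (1 : ℝ≥0∞) else 0) = 2 ^ d := by
  have hinv : Function.Involutive fun s : Fin d → Label => Function.update s j (!s j) := by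
    intro s
    simp
  have hflip : ∑ s : Fin d → Label, (if g s ≠ s j then (1 : ℝ≥0∞) else 0) =
      ∑ s : Fin d → Label, if g s = s j then (1 : ℝ≥0∞) else 0 := by
    rw [← Equiv.sum_comp hinv.toPerm]
    refine Finset.sum_congr rfl fun s _ => ?_
    simp only [Function.Involutive.coe_toPerm, hg, Function.update_self]
    cases g s <;> cases s j <;> simp
  rw [two_mul]
  nth_rewrite 2 [hflip]
  rw [← Finset.sum_add_distrib]
  have : ∀ s : Fin d → Label, ((if g s ≠ s j then (1 : ℝ≥0∞) else 0) +
      if g s = s j then (1 : ℝ≥0∞) else 0) = 1 := fun s => by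
    by_cases h : g s = s j <;> simp [h]
  rw [Finset.sum_congr rfl fun s _ => this s]
  simp

/-- The probability that an atom of mass `q ≤ 1 / (2 n)` is missing from a sample. -/
lemma half_le_pi_missing {ι : Type*} [Fintype ι] [MeasurableSpace ι] [MeasurableSingletonClass ι]
    (μ : Measure ι) [IsProbabilityMeasure μ] {a : ι} {q : ℝ} (hq : 0 ≤ q) (hnq : n * q ≤ 1 / 2)
    (ha : μ {a} = ENNReal.ofReal q) :
    ENNReal.ofReal (1 / 2) ≤ Measure.pi (fun _ : Fin n => μ) {I | ∀ k, I k ≠ a} := by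
  have hset : {I : Fin n → ι | ∀ k, I k ≠ a} = Set.univ.pi fun _ => {a}ᶜ := by
    ext I
    simp
  rw [hset, Measure.pi_pi, prob_compl_eq_one_sub (measurableSet_singleton a), ha, Finset.prod_const,
    Finset.card_univ, Fintype.card_fin]
  rcases Nat.eq_zero_or_pos n with rfl | hn
  · simp
  have hq1 : q ≤ 1 / 2 := by
    have h1 : (1 : ℝ) ≤ n := by exact_mod_cast hn
    nlinarith
  rw [← ENNReal.ofReal_one, ← ENNReal.ofReal_sub _ hq, ← ENNReal.ofReal_pow (by linarith)]
  refine ENNReal.ofReal_le_ofReal ?_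
  have := one_add_mul_le_pow (a := -q) (by linarith) n
  rw [← sub_eq_add_neg] at this
  linarith

/-- The sample law of an injective image of a finite space. The integrand is arbitrary, so it need
not be measurable. -/
lemma sampleLaw_map {ι : Type*} [Finite ι] [MeasurableSpace ι] [MeasurableSingletonClass ι]
    (μ : Measure ι) [IsProbabilityMeasure μ] {φ : ι → Example d} (hφ : Function.Injective φ)
    (F : (Fin n → Example d) → ℝ≥0∞) :
    ∫⁻ S, F S ∂(sampleLaw (μ.map φ) n) =
      ∫⁻ I, F (fun k => φ (I k)) ∂(Measure.pi fun _ : Fin n => μ) := by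
  have hmeas : Measurable φ := measurable_of_countable φ
  have : IsProbabilityMeasure (μ.map φ) := Measure.isProbabilityMeasure_map hmeas.aemeasurable
  have hemb : MeasurableEmbedding fun (I : Fin n → ι) k => φ (I k) :=
    ⟨fun I I' h => funext fun k => hφ (congrFun h k), measurable_of_countable _,
      fun s _ => (s.to_countable.image _).measurableSet⟩
  rw [sampleLaw, ← Measure.pi_map_pi fun _ => hmeas.aemeasurable, hemb.lintegral_map]

/-- On the hard distribution, a classifier loses the mass of every atom `inl j` for which its value
at the common point `L • e_j` of the two possible balls is not the label `s j`. -/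
lemma sum_le_robustLoss_map_hardAtom {p : ℝ≥0∞} (hp : 1 < p) {r m q : ℝ} (hm : 0 < m)
    (hball : lpNorm p (m • ones d) ≤ r) (μ : Measure (Fin d ⊕ Label))
    (hμ : ∀ j, μ {Sum.inl j} = ENNReal.ofReal q) (s : Fin d → Label) (f : Classifier d) :
    ∑ j, (if f ((m / 2) • EuclideanSpace.single j 1) ≠ s j then ENNReal.ofReal q else 0) ≤
      robustLoss p r f (μ.map (hardAtom (m / 2) m s)) := by
  classical
  have hemb : MeasurableEmbedding (hardAtom (m / 2) m s) :=
    ⟨hardAtom_injective hm s, measurable_of_countable _,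
      fun t _ => (t.to_countable.image _).measurableSet⟩
  rw [robustLoss, hemb.map_apply, ← Finset.sum_filter]
  set J := Finset.univ.filter fun j => f ((m / 2) • EuclideanSpace.single j 1) ≠ s j with hJ
  calc ∑ _j ∈ J, ENNReal.ofReal q = ∑ i ∈ J.map Function.Embedding.inl, μ {i} := by
        rw [Finset.sum_map]
        exact Finset.sum_congr rfl fun j _ => (hμ j).symm
    _ = μ (J.map Function.Embedding.inl : Finset (Fin d ⊕ Label)) := sum_measure_singleton
    _ ≤ _ := by
        refine measure_mono fun i hi => ?_
        obtain ⟨j, hj, rfl⟩ := Finset.mem_map.1 (Finset.mem_coe.1 hi)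
        refine ⟨_, ?_, (Finset.mem_filter.1 hj).2⟩
        change lpNorm p _ ≤ r
        simp only [Function.Embedding.inl_apply, hardAtom, sub_add_cancel_left]
        rw [lpNorm_neg hp]
        cases s j
        · rw [sgn_false, neg_one_mul, neg_smul, lpNorm_neg hp]
          exact hball
        · rw [sgn_true, one_mul]
          exact hball

/-- The average over the patterns `s` of the expected robust loss is at least `d q / 4`: an atom
`inl j` is missing from the sample with probability at least `1 / 2`, and then the prediction at
`L • e_j` is independent of `s j`. -/
lemma exists_pattern_le_expRobustLoss {p : ℝ≥0∞} (hp : 1 < p) {r m q : ℝ} (hm : 0 < m) (hq : 0 ≤ q)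
    (hnq : n * q ≤ 1 / 2) (hball : lpNorm p (m • ones d) ≤ r)
    (μ : Measure (Fin d ⊕ Label)) [IsProbabilityMeasure μ]
    (hμ : ∀ j, μ {Sum.inl j} = ENNReal.ofReal q) (A : LearningAlgorithm d) :
    ∃ s : Fin d → Label, ENNReal.ofReal (d * q / 4) ≤
      expRobustLoss p r A n (μ.map (hardAtom (m / 2) m s)) := by
  classical
  set φ : (Fin d → Label) → Fin d ⊕ Label → Example d := hardAtom (m / 2) m with hφ
  set X : Fin d → Pt d := fun j => (m / 2) • EuclideanSpace.single j 1 with hX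
  set Loss : (Fin d → Label) → ℝ≥0∞ := fun s => expRobustLoss p r A n (μ.map (φ s)) with hLoss
  set π : Measure (Fin n → Fin d ⊕ Label) := Measure.pi fun _ => μ with hπ
  have hs : ∀ s, ∫⁻ I, ∑ j, (if A n (fun k => φ s (I k)) (X j) ≠ s j then ENNReal.ofReal q else 0)
      ∂π ≤ Loss s := by
    intro s
    rw [hLoss]
    simp only [expRobustLoss]
    rw [sampleLaw_map μ (hardAtom_injective hm s)]
    exact lintegral_mono fun I => sum_le_robustLoss_map_hardAtom hp hm hball μ hμ s _
  -- the average over the patterns for a fixed sample of atoms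
  have hI : ∀ I : Fin n → Fin d ⊕ Label,
      ∑ j, {I : Fin n → Fin d ⊕ Label | ∀ k, I k ≠ Sum.inl j}.indicator
        (fun _ => ENNReal.ofReal q * 2 ^ d) I ≤
      2 * ∑ s, ∑ j, (if A n (fun k => φ s (I k)) (X j) ≠ s j then ENNReal.ofReal q else 0) := by
    intro I
    rw [Finset.sum_comm, Finset.mul_sum]
    refine Finset.sum_le_sum fun j _ => ?_
    rw [Set.indicator_apply]
    split_ifs with hmiss
    · have hg : ∀ s : Fin d → Label,
          A n (fun k => φ (Function.update s j (!s j)) (I k)) (X j) =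
            A n (fun k => φ s (I k)) (X j) := by
        intro s
        congr 1
        ext1 k
        rcases hk : I k with l | y
        · have hlj : l ≠ j := by
            rintro rfl
            exact hmiss k hk
          simp only [hφ, hardAtom, Function.update_of_ne hlj]
        · rfl
      rw [← two_mul_sum_indicator_ne j (fun s => A n (fun k => φ s (I k)) (X j)) hg, mul_left_comm,
        Finset.mul_sum]
      simp only [mul_ite, mul_one, mul_zero, le_refl]
    · exact bot_le
  have htotal : ENNReal.ofReal (d * q / 2) * 2 ^ d ≤ 2 * ∑ s, Loss s := by
    calc ENNReal.ofReal (d * q / 2) * 2 ^ d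
        = ∑ _j : Fin d, ENNReal.ofReal q * 2 ^ d * ENNReal.ofReal (1 / 2) := by
          rw [Finset.sum_const, Finset.card_univ, Fintype.card_fin, nsmul_eq_mul,
            mul_right_comm, ← ENNReal.ofReal_mul hq, ← mul_assoc, ← ENNReal.ofReal_natCast,
            ← ENNReal.ofReal_mul (by positivity)]
          congr 2
          ring
      _ ≤ ∑ j, ∫⁻ I, {I : Fin n → Fin d ⊕ Label | ∀ k, I k ≠ Sum.inl j}.indicator
            (fun _ => ENNReal.ofReal q * 2 ^ d) I ∂π := by
          refine Finset.sum_le_sum fun j _ => ?_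
          rw [lintegral_indicator_const (Set.toFinite _).measurableSet]
          exact mul_le_mul_right (half_le_pi_missing μ hq hnq (hμ j)) _
      _ = ∫⁻ I, ∑ j, {I : Fin n → Fin d ⊕ Label | ∀ k, I k ≠ Sum.inl j}.indicator
            (fun _ => ENNReal.ofReal q * 2 ^ d) I ∂π :=
          (lintegral_finsetSum _ fun j _ => measurable_of_countable _).symm
      _ ≤ ∫⁻ I, 2 * ∑ s, ∑ j, (if A n (fun k => φ s (I k)) (X j) ≠ s j
            then ENNReal.ofReal q else 0) ∂π := lintegral_mono hI
      _ = 2 * ∑ s, ∫⁻ I, ∑ j, (if A n (fun k => φ s (I k)) (X j) ≠ s j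
            then ENNReal.ofReal q else 0) ∂π := by
          rw [lintegral_const_mul _ (measurable_of_countable _),
            lintegral_finsetSum _ fun s _ => measurable_of_countable _]
      _ ≤ 2 * ∑ s, Loss s := by
          gcongr with s
          exact hs s
  obtain ⟨s, -, hmax⟩ := Finset.exists_max_image Finset.univ Loss Finset.univ_nonempty
  refine ⟨s, ?_⟩
  have hle : ∑ s', Loss s' ≤ 2 ^ d * Loss s := by
    calc ∑ s', Loss s' ≤ ∑ _s' : Fin d → Label, Loss s := Finset.sum_le_sum hmax
      _ = _ := by simp
  have h4 : 2 * ENNReal.ofReal (d * q / 4) = ENNReal.ofReal (d * q / 2) := by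
    rw [← ENNReal.ofReal_ofNat, ← ENNReal.ofReal_mul (by norm_num)]
    congr 1
    ring
  have h5 : (2 * 2 ^ d) * ENNReal.ofReal (d * q / 4) ≤ (2 * 2 ^ d) * Loss s := by
    calc (2 * 2 ^ d) * ENNReal.ofReal (d * q / 4) = ENNReal.ofReal (d * q / 2) * 2 ^ d := by
          rw [← h4]
          ring
      _ ≤ 2 * (2 ^ d * Loss s) := htotal.trans (by gcongr)
      _ = _ := by ring
  exact (ENNReal.mul_le_mul_iff_right (by positivity) (by finiteness)).1 h5

lemma robust_lower_bound (hd : 0 < d) {p : ℝ≥0∞} (hp : 1 < p) {r ρ : ℝ} (hr : 0 < r) (hρ : 12 ≤ ρ)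
    (A : LearningAlgorithm d) (hn : 0 < n) :
    ∃ D ∈ Family d p r ρ,
      ENNReal.ofReal (1 / 8 * min 1 ((d : ℝ) / n)) ≤ expRobustLoss p r A n D := by
  obtain ⟨m, hm, hball, htilt⟩ := exists_tilt_bound hd hp hr
  obtain ⟨η, hη0, hη1, hη⟩ := htilt (m / 4) (by positivity)
  have hd' : (0 : ℝ) < d := by exact_mod_cast hd
  have hn' : (0 : ℝ) < n := by exact_mod_cast hn
  -- atoms of mass `1 / (2 max n d)`: light enough to be missed by `n` examples, and to leave half of
  -- the total mass for the two atoms that do not depend on the pattern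
  set M : ℝ := max n d with hM
  have hM0 : 0 < M := lt_max_of_lt_left hn'
  have hq : ∀ k : ℝ, k ≤ M → k * (1 / (2 * M)) ≤ 1 / 2 := fun k hk => by
    rw [mul_one_div, div_le_div_iff₀ (by positivity) (by positivity)]
    linarith
  obtain ⟨μ, hprob, hμ, hμ0⟩ := exists_atomMeasure (d := d) (q := 1 / (2 * M)) (by positivity)
    (hq d (le_max_right _ _))
  obtain ⟨s, hs⟩ := exists_pattern_le_expRobustLoss hp hm (by positivity) (hq n (le_max_left _ _))
    hball μ hμ A
  refine ⟨_, map_hardAtom_mem_family hd hp hρ hm hη0 hη1 s (hη s) μ hμ0, le_trans ?_ hs⟩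
  refine ENNReal.ofReal_le_ofReal ?_
  have : min 1 ((d : ℝ) / n) ≤ d / M := by
    rcases le_total (n : ℝ) d with h | h
    · rw [hM, max_eq_right h, div_self hd'.ne']
      exact min_le_left _ _
    · rw [hM, max_eq_left h]
      exact min_le_right _ _
  calc 1 / 8 * min 1 ((d : ℝ) / n) ≤ 1 / 8 * (d / M) := by gcongr
    _ = _ := by
        field_simp
        norm_num

end RobustLinear

theorem theorem3p1 :
    (∃ c : ℝ, 0 < c ∧
      ∀ (d : ℕ) (p : ENNReal) (r ρ : ℝ), 1 ≤ d → 1 < p → 0 < r → 20 < ρ →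
      ∀ (A : RobustLinear.LearningAlgorithm d) (n : ℕ), 1 ≤ n →
        ∃ D ∈ RobustLinear.Family d p r ρ,
          ENNReal.ofReal (c * min 1 ((d : ℝ) / n)) ≤ RobustLinear.expRobustLoss p r A n D) ∧
    (∃ c' : ℝ, 0 < c' ∧
      ∀ (d : ℕ) (p : ENNReal) (r ρ : ℝ), 1 ≤ d → 1 < p → 0 < r → 20 < ρ →
      ∀ D ∈ RobustLinear.Family d p r ρ, ∀ n : ℕ, 1 ≤ n →
        AEMeasurable
          (fun S => RobustLinear.stdLoss (RobustLinear.hardMarginSVM d n S) D)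
          (RobustLinear.sampleLaw D n) ∧
        RobustLinear.expStdLoss (RobustLinear.hardMarginSVM d) n D
          ≤ ENNReal.ofReal (c' * ρ ^ 2 / n)) := by
  refine ⟨⟨1 / 8, by norm_num, fun d p r ρ hd hp hr hρ A n hn => ?_⟩,
    1, one_pos, fun d p r ρ _ hp hr hρ D hD n hn => ?_⟩
  · exact RobustLinear.robust_lower_bound hd hp hr (by linarith) A hn
  · obtain ⟨hmeas, hle⟩ := RobustLinear.hardMarginSVM_upper_bound hp hr (by linarith) hD hn
    exact ⟨hmeas.aemeasurable, by rwa [one_mul]⟩
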